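/- **Setting.** Let $X$ be a paracompact Hausdorff space and $n\ge 0$. An orbifold structure on $X$ in the sense of Satake (with Kawasaki's axioms) is a cover of $X$ by open sets $U_i$ such that: (1) each $U_i$ has a uniformizing system $(\widehat U_i,G_i,\pi_i)$, where $\widehat U_i$ is a connected (non-empty) open subset of $\mathbb R^n$, $G_i$ is a finite group of $C^\infty$ self-diffeomorphisms of $\widehat U_i$, and $\pi_i:\widehat U_i\to U_i$ is a continuous map inducing a homeomorphism $\widehat U_i/G_i\cong U_i$; (2) whenever $U_j\subseteq U_i$ (including $j=i$) there is given a set of injections, i.e. smooth open embeddings $\phi:\widehat U_j\to\widehat U_i$ with $\pi_i\circ\phi=\pi_j$, on which $G_i$ acts freely and transitively by post-composition, and for $U_k\subseteq U_j\subseteq U_i$ the composition of an injection $\widehat U_k\to\widehat U_j$ with an injection $\widehat U_j\to\widehat U_i$ is an injection $\widehat U_k\to\widehat U_i$; (3) every $p\in U_i\cap U_j$ lies in some $U_k\subseteq U_i\cap U_j$. The injections generate a pseudogroup of local diffeomorphisms of $\bigsqcup_i\widehat U_i$; the associated étale topological groupoid $\Gamma$ is the space of germs of its members, with the étale topology, with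 source and target maps $\alpha,\omega$ to the space of units $\bigsqcup_i\widehat U_i$. An equivalence of étale topological groupoids is a continuous homomorphism that is a local homeomorphism and induces a bijection of orbit sets and isomorphisms of isotropy groups. For an étale topological groupoid $\Gamma'$ with space of units a disjoint union $\bigsqcup_\alpha\widehat V_\alpha$, write $\Gamma'(V_\alpha,V_\beta)$ for the set of arrows with source in $\widehat V_\alpha$ and target in $\widehat V_\beta$, and consider the conditions: (C1) $\Gamma'$ is locally connected. (C2) For all $\alpha,\beta$, the restriction of the source map (resp. target map) to any connected component of $\Gamma'(V_\alpha,V_\beta)$ is a homeomorphism onto a connected component of the image of $\Gamma'(V_\alpha,V_\beta)$ under the source map in $\widehat V_\alpha$ (resp. under the target map in $\widehat V_\beta$). **Proposition.** For every orbifold $(X,\{U_i\})$ as above there is an open cover $\{V_\alpha\}$ of $X$ by connected open sets refining $\{U_i\}$, with a choice of indices $i(\alpha)$ such that $V_\alpha\subseteq U_{i(\alpha)}$, for which the following holds. For each $\alpha$ let $\widehat V_\alpha\subseteq\widehat U_{i(\alpha)}$ be the inverse image $\pi_{i(\alpha)}^{-1}(V_\alpha)$ or any connected component of it (any choice, independently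 for each $\alpha$), and let $G_{V_\alpha}\subseteq G_{i(\alpha)}$ be the stabilizer of the set $\widehat V_\alpha$. Let $\Gamma'$ be the restriction of $\Gamma$ to $\bigsqcup_\alpha\widehat V_\alpha$, i.e. the groupoid with space of units $\bigsqcup_\alpha\widehat V_\alpha$ whose arrows from $x$ to $y$ are the arrows of $\Gamma$ between their images in $\bigsqcup_i\widehat U_i$. Then the natural homomorphism $\Gamma'\to\Gamma$ is an equivalence of étale topological groupoids; $\Gamma'$ defines an orbispace structure on $X$ with charts $(\widehat V_\alpha,G_{V_\alpha},\pi_{i(\alpha)})$ (that is, $\pi_{i(\alpha)}$ induces a homeomorphism $\widehat V_\alpha/G_{V_\alpha}\cong V_\alpha$, the restriction of $\Gamma'$ to each $\widehat V_\alpha$ is isomorphic, by an isomorphism that is the identity on units, to the product groupoid $G_{V_\alpha}\times\widehat V_\alpha$, and the $\pi_{i(\alpha)}$ induce a homeomorphism from the space of $\Gamma'$-orbits to $X$); and $\Gamma'$ satisfies (C1) and (C2). -/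

import Mathlib

open scoped Manifold ContDiff Topology Pointwise

universe u v w

/-! ### Topological groupoids -/

/-- A topological groupoid with space of units `U`: a space of arrows `Arr`, the maps `src` (right
unit, `α`) and `tgt` (left unit, `ω`), the composition `comp h g = h ∘ g`, defined when
`src h = tgt g`, units and inverses, all structure maps being continuous. (As `src (unit x) = x`,
the topology of `U` is the one induced from `Arr` through `unit`.) -/
structure TopologicalGroupoid (U : Type u) [TopologicalSpace U] where
  Arr : Type v
  [topArr : TopologicalSpace Arr]
  src : Arr → U
  tgt : Arr → U
  comp : (h g : Arr) → src h = tgt g → Arr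
  unit : U → Arr
  inv : Arr → Arr
  src_comp : ∀ h g hg, src (comp h g hg) = src g
  tgt_comp : ∀ h g hg, tgt (comp h g hg) = tgt h
  src_unit : ∀ x, src (unit x) = x
  tgt_unit : ∀ x, tgt (unit x) = x
  src_inv : ∀ g, src (inv g) = tgt g
  tgt_inv : ∀ g, tgt (inv g) = src g
  assoc : ∀ k h g (hkh : src k = tgt h) (hhg : src h = tgt g),
    comp k (comp h g hhg) (hkh.trans (tgt_comp h g hhg).symm) =
      comp (comp k h hkh) g ((src_comp k h hkh).trans hhg)
  unit_comp : ∀ g, comp (unit (tgt g)) g (src_unit _) = g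
  comp_unit : ∀ g, comp g (unit (src g)) (tgt_unit _).symm = g
  inv_comp : ∀ g, comp (inv g) g (src_inv g) = unit (src g)
  comp_inv : ∀ g, comp g (inv g) (tgt_inv g).symm = unit (tgt g)
  continuous_src : Continuous src
  continuous_tgt : Continuous tgt
  continuous_unit : Continuous unit
  continuous_inv : Continuous inv
  continuous_comp : Continuous fun p : {p : Arr × Arr // src p.1 = tgt p.2} =>
    comp p.1.1 p.1.2 p.2

attribute [instance] TopologicalGroupoid.topArr

namespace TopologicalGroupoid

section

variable {U : Type*} [TopologicalSpace U] {U' : Type*} [TopologicalSpace U']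

/-- Étale: `α` and `ω` are local homeomorphisms. -/
structure IsEtale (Γ : TopologicalGroupoid U) : Prop where
  src : IsLocalHomeomorph Γ.src
  tgt : IsLocalHomeomorph Γ.tgt

/-- Two units are equivalent when they lie in the same `Γ`-orbit. -/
def orbitSetoid (Γ : TopologicalGroupoid U) : Setoid U where
  r x y := ∃ g : Γ.Arr, Γ.src g = x ∧ Γ.tgt g = y
  iseqv :=
    { refl := fun x => ⟨Γ.unit x, Γ.src_unit x, Γ.tgt_unit x⟩
      symm := fun ⟨g, h₁, h₂⟩ => ⟨Γ.inv g, (Γ.src_inv g).trans h₂, (Γ.tgt_inv g).trans h₁⟩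
      trans := fun ⟨g, h₁, h₂⟩ ⟨k, h₃, h₄⟩ =>
        ⟨Γ.comp k g (h₃.trans h₂.symm), (Γ.src_comp _ _ _).trans h₁, (Γ.tgt_comp _ _ _).trans h₄⟩ }

/-- The space of `Γ`-orbits, with the quotient topology. -/
abbrev Orbits (Γ : TopologicalGroupoid U) : Type _ := Quotient Γ.orbitSetoid

/-- The isotropy group (as a set of arrows) of a unit. -/
def isotropy (Γ : TopologicalGroupoid U) (x : U) : Set Γ.Arr :=
  {g | Γ.src g = x ∧ Γ.tgt g = x}

/-- A homomorphism of topological groupoids. -/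
structure Hom (Γ : TopologicalGroupoid U) (Γ' : TopologicalGroupoid U') where
  obj : U → U'
  map : Γ.Arr → Γ'.Arr
  continuous_obj : Continuous obj
  continuous_map : Continuous map
  src_map : ∀ g, Γ'.src (map g) = obj (Γ.src g)
  tgt_map : ∀ g, Γ'.tgt (map g) = obj (Γ.tgt g)
  map_unit : ∀ x, map (Γ.unit x) = Γ'.unit (obj x)
  map_inv : ∀ g, map (Γ.inv g) = Γ'.inv (map g)
  map_comp : ∀ h g hg, map (Γ.comp h g hg) =
    Γ'.comp (map h) (map g) ((src_map h).trans ((congrArg obj hg).trans (tgt_map g).symm))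

/-- The map induced by a homomorphism on the orbit spaces. -/
def Hom.orbitMap {Γ : TopologicalGroupoid U} {Γ' : TopologicalGroupoid U'} (Φ : Hom Γ Γ') :
    Γ.Orbits → Γ'.Orbits :=
  Quotient.map Φ.obj fun _ _ ⟨g, h₁, h₂⟩ =>
    ⟨Φ.map g, (Φ.src_map g).trans (congrArg Φ.obj h₁), (Φ.tgt_map g).trans (congrArg Φ.obj h₂)⟩

/-- An equivalence of étale topological groupoids: a homomorphism which is a local homeomorphism
and induces a bijection between the orbit spaces and isomorphisms between the isotropy groups
(being compatible with composition, `Φ` restricts to a group homomorphism between these). -/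
structure Hom.IsEquivalence {Γ : TopologicalGroupoid U} {Γ' : TopologicalGroupoid U'}
    (Φ : Hom Γ Γ') : Prop where
  etale_source : Γ.IsEtale
  etale_target : Γ'.IsEtale
  localHomeo : IsLocalHomeomorph Φ.map
  orbits : Function.Bijective Φ.orbitMap
  isotropy : ∀ x, Set.BijOn Φ.map (Γ.isotropy x) (Γ'.isotropy (Φ.obj x))

/-- The restriction of `Γ` along a continuous map `F : V → U` into its space of units: the arrows
from `x` to `y` are the arrows of `Γ` from `F x` to `F y`. If `F` is the inclusion of a subspace,
this is the usual restriction of `Γ` to that subspace. -/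
def restrict (Γ : TopologicalGroupoid U) {V : Type*} [TopologicalSpace V] (F : V → U)
    (hF : Continuous F) : TopologicalGroupoid V where
  Arr := {t : V × V × Γ.Arr // Γ.src t.2.2 = F t.1 ∧ Γ.tgt t.2.2 = F t.2.1}
  src t := t.1.1
  tgt t := t.1.2.1
  comp h g hg := ⟨(g.1.1, h.1.2.1, Γ.comp h.1.2.2 g.1.2.2
      (h.2.1.trans ((congrArg F hg).trans g.2.2.symm))),
    (Γ.src_comp _ _ _).trans g.2.1, (Γ.tgt_comp _ _ _).trans h.2.2⟩
  unit x := ⟨(x, x, Γ.unit (F x)), Γ.src_unit _, Γ.tgt_unit _⟩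
  inv g := ⟨(g.1.2.1, g.1.1, Γ.inv g.1.2.2), (Γ.src_inv _).trans g.2.2, (Γ.tgt_inv _).trans g.2.1⟩
  src_comp _ _ _ := rfl
  tgt_comp _ _ _ := rfl
  src_unit _ := rfl
  tgt_unit _ := rfl
  src_inv _ := rfl
  tgt_inv _ := rfl
  assoc k h g hkh hhg := by
    simp only [Subtype.mk.injEq, Prod.mk.injEq, true_and]
    exact Γ.assoc _ _ _ _ _
  unit_comp := by
    rintro ⟨⟨x, y, g⟩, hs, ht⟩
    dsimp only at hs ht
    simp only [Subtype.mk.injEq, Prod.mk.injEq, true_and, ← ht]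
    exact Γ.unit_comp g
  comp_unit := by
    rintro ⟨⟨x, y, g⟩, hs, ht⟩
    dsimp only at hs ht
    simp only [Subtype.mk.injEq, Prod.mk.injEq, true_and, ← hs]
    exact Γ.comp_unit g
  inv_comp := by
    rintro ⟨⟨x, y, g⟩, hs, ht⟩
    dsimp only at hs ht
    simp only [Subtype.mk.injEq, Prod.mk.injEq, true_and, ← hs]
    exact Γ.inv_comp g
  comp_inv := by
    rintro ⟨⟨x, y, g⟩, hs, ht⟩
    dsimp only at hs ht
    simp only [Subtype.mk.injEq, Prod.mk.injEq, true_and, ← ht]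
    exact Γ.comp_inv g
  continuous_src := by fun_prop
  continuous_tgt := by fun_prop
  continuous_unit := by
    have := Γ.continuous_unit
    fun_prop
  continuous_inv := by
    have := Γ.continuous_inv
    fun_prop
  continuous_comp := by
    refine Continuous.subtype_mk (Continuous.prodMk (by fun_prop)
      (Continuous.prodMk (by fun_prop) ?_)) _
    refine Γ.continuous_comp.comp (Continuous.subtype_mk (f := fun p :
      {p : {t : V × V × Γ.Arr // Γ.src t.2.2 = F t.1 ∧ Γ.tgt t.2.2 = F t.2.1} ×
        {t : V × V × Γ.Arr // Γ.src t.2.2 = F t.1 ∧ Γ.tgt t.2.2 = F t.2.1} //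
          p.1.1.1 = p.2.1.2.1} => (p.1.1.1.2.2, p.1.2.1.2.2)) (by fun_prop) fun p =>
        p.1.1.2.1.trans ((congrArg F p.2).trans p.1.2.2.2.symm))

/-- The natural homomorphism from a restriction of `Γ` to `Γ`. -/
def restrictHom (Γ : TopologicalGroupoid U) {V : Type*} [TopologicalSpace V] (F : V → U)
    (hF : Continuous F) : Hom (Γ.restrict F hF) Γ where
  obj := F
  map t := t.1.2.2
  continuous_obj := hF
  continuous_map := continuous_subtype_val.snd.snd
  src_map t := t.2.1
  tgt_map t := t.2.2
  map_unit _ := rfl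
  map_inv _ := rfl
  map_comp _ _ _ := rfl

/-- The product groupoid `G × Y` of a discrete group `G` acting continuously on a space `Y`. -/
def product (G : Type*) [Group G] [TopologicalSpace G] [DiscreteTopology G] (Y : Type*)
    [TopologicalSpace Y] [MulAction G Y] [ContinuousConstSMul G Y] : TopologicalGroupoid Y where
  Arr := G × Y
  src g := g.2
  tgt g := g.1 • g.2
  comp h g _ := (h.1 * g.1, g.2)
  unit y := (1, y)
  inv g := (g.1⁻¹, g.1 • g.2)
  src_comp _ _ _ := rfl
  tgt_comp := by
    rintro ⟨h, z⟩ ⟨g, y⟩ hg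
    dsimp only at hg ⊢
    rw [hg, mul_smul]
  src_unit _ := rfl
  tgt_unit y := one_smul G y
  src_inv _ := rfl
  tgt_inv g := inv_smul_smul g.1 g.2
  assoc _ _ _ _ _ := by simp [mul_assoc]
  unit_comp _ := by simp
  comp_unit _ := by simp
  inv_comp _ := by simp
  comp_inv _ := by simp
  continuous_src := continuous_snd
  continuous_tgt := continuous_prod_of_discrete_left.mpr fun g => continuous_const_smul g
  continuous_unit := by fun_prop
  continuous_inv := (continuous_of_discreteTopology.comp continuous_fst).prodMk
    (continuous_prod_of_discrete_left.mpr fun g => continuous_const_smul g)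
  continuous_comp := by fun_prop

end

/-! ### Orbispace structures and the conditions (C1), (C2) -/

section

variable {A : Type*} {Y : A → Type*} [∀ a, TopologicalSpace (Y a)]

/-- `Γ(U_a, U_b)`: the arrows of `Γ` from the chart `Y a` to the chart `Y b`. -/
def chartArrows (Γ : TopologicalGroupoid (Σ a, Y a)) (a b : A) : Set Γ.Arr :=
  {g | (Γ.src g).1 = a ∧ (Γ.tgt g).1 = b}

/-- Condition (C1): the groupoid is locally connected. -/
def C1 (Γ : TopologicalGroupoid (Σ a, Y a)) : Prop := LocallyConnectedSpace Γ.Arr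

/-- Condition (C2): for any two charts, the restriction of `α` (resp. `ω`) to any connected
component `C` of `Γ(U_a, U_b)` is a homeomorphism onto a connected component of the image of
`Γ(U_a, U_b)` under `α` (resp. `ω`). -/
def C2 (Γ : TopologicalGroupoid (Σ a, Y a)) : Prop :=
  ∀ a b, ∀ g ∈ Γ.chartArrows a b,
    let C := connectedComponentIn (Γ.chartArrows a b) g
    (Topology.IsEmbedding (C.domRestrict Γ.src) ∧
      Γ.src '' C = connectedComponentIn (Γ.src '' Γ.chartArrows a b) (Γ.src g)) ∧
    (Topology.IsEmbedding (C.domRestrict Γ.tgt) ∧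
      Γ.tgt '' C = connectedComponentIn (Γ.tgt '' Γ.chartArrows a b) (Γ.tgt g))

end

end TopologicalGroupoid

/-- `π : Y → X` is continuous and induces a homeomorphism of `Y / G` onto the subset `V` of `X`. -/
def InducesHomeomorph {X Y : Type*} [TopologicalSpace X] [TopologicalSpace Y] (G : Type*) [Group G]
    [MulAction G Y] (π : Y → X) (V : Set X) : Prop :=
  ∃ h : MulAction.orbitRel.Quotient G Y ≃ₜ V, ∀ y : Y, (h (Quotient.mk _ y) : X) = π y

/-- The topological groupoid `Γ` with space of units `⨆ Y a` defines an orbispace structure on `X`,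
with charts `(Y a, G a, π a)` over the open sets `V a`, the groups `G a` being discrete. -/
structure TopologicalGroupoid.IsOrbispace {X : Type*} [TopologicalSpace X] {A : Type*}
    {Y : A → Type*} [∀ a, TopologicalSpace (Y a)] (Γ : TopologicalGroupoid (Σ a, Y a))
    (V : A → Set X) (G : A → Type*) [∀ a, Group (G a)] [∀ a, MulAction (G a) (Y a)]
    [∀ a, ContinuousConstSMul (G a) (Y a)] (π : ∀ a, Y a → X) : Prop where
  etale : Γ.IsEtale
  isOpen : ∀ a, IsOpen (V a)
  cover : ⋃ a, V a = Set.univ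
  chart : ∀ a, InducesHomeomorph (G a) (π a) (V a)
  /-- The restriction of `Γ` to each chart is the product groupoid `G a × Y a`. -/
  product : ∀ a, letI : TopologicalSpace (G a) := ⊥
    haveI : DiscreteTopology (G a) := ⟨rfl⟩
    ∃ Φ : Hom (TopologicalGroupoid.product (G a) (Y a))
        (Γ.restrict (Sigma.mk a) continuous_sigmaMk),
      Φ.obj = id ∧ IsHomeomorph Φ.map
  /-- `X` is the space of `Γ`-orbits. -/
  orbits : ∃ h : Γ.Orbits ≃ₜ X, ∀ a (y : Y a), h (Quotient.mk _ ⟨a, y⟩) = π a y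

/-! ### The groupoid of germs of a pseudogroup -/

section Germs

variable {M : Type u} [TopologicalSpace M]

/-- Pairs of a member `e` of the pseudogroup `P` and a point `x` of its source, two of them being
identified when the points agree and the members agree near that point. -/
def germSetoid (P : StructureGroupoid M) :
    Setoid {p : M × OpenPartialHomeomorph M M // p.2 ∈ P ∧ p.1 ∈ p.2.source} where
  r p q := p.1.1 = q.1.1 ∧ p.1.2 =ᶠ[𝓝 p.1.1] q.1.2
  iseqv :=
    { refl := fun _ => ⟨rfl, Filter.EventuallyEq.rfl⟩
      symm := fun ⟨h₁, h₂⟩ => ⟨h₁.symm, h₁ ▸ h₂.symm⟩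
      trans := fun ⟨h₁, h₂⟩ ⟨h₃, h₄⟩ => ⟨h₁.trans h₃, h₂.trans (h₁ ▸ h₄)⟩ }

/-- The germs of the members of the pseudogroup `P`. -/
def PseudogroupGerm (P : StructureGroupoid M) : Type u := Quotient (germSetoid P)

namespace PseudogroupGerm

variable {P : StructureGroupoid M}

/-- The germ of `e` at `x`. -/
def mk (e : OpenPartialHomeomorph M M) (he : e ∈ P) (x : M) (hx : x ∈ e.source) :
    PseudogroupGerm P :=
  Quotient.mk (germSetoid P) ⟨(x, e), he, hx⟩

theorem exists_mk (g : PseudogroupGerm P) : ∃ e he x hx, g = mk e he x hx := by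
  obtain ⟨⟨⟨x, e⟩, he, hx⟩, rfl⟩ := Quotient.exists_rep g
  exact ⟨e, he, x, hx, rfl⟩

theorem mk_eq_mk {e e' : OpenPartialHomeomorph M M} {he he'} {x x' : M} {hx hx'} :
    (mk e he x hx : PseudogroupGerm P) = mk e' he' x' hx' ↔ x = x' ∧ e =ᶠ[𝓝 x] e' :=
  Quotient.eq

/-- The point at which a germ is taken. -/
def src : PseudogroupGerm P → M := Quotient.lift (fun p => p.1.1) fun _ _ h => h.1

/-- The value of a germ at that point. -/
def tgt : PseudogroupGerm P → M := Quotient.lift (fun p => p.1.2 p.1.1) fun p q h => by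
  have := h.2.eq_of_nhds
  rw [this, h.1]

/-- The germ of the inverse. -/
def inv : PseudogroupGerm P → PseudogroupGerm P :=
  Quotient.lift (fun p => mk p.1.2.symm (P.symm p.2.1) (p.1.2 p.1.1) (p.1.2.map_source p.2.2)) <| by
    rintro ⟨⟨x, e⟩, he, hx⟩ ⟨⟨x', e'⟩, he', hx'⟩ ⟨h₁, h₂⟩
    dsimp only at *
    subst h₁
    have h₃ : e x = e' x := h₂.eq_of_nhds
    refine mk_eq_mk.mpr ⟨h₃, ?_⟩
    have t₁ : Filter.Tendsto e.symm (𝓝 (e x)) (𝓝 x) := e.tendsto_symm hx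
    have hx'' : e x ∈ e'.target := h₃ ▸ e'.map_source hx'
    filter_upwards [t₁.eventually h₂, t₁.eventually (e'.open_source.mem_nhds hx'),
      e.open_target.mem_nhds (e.map_source hx)] with y hy hy' hy''
    rw [e.right_inv hy''] at hy
    calc e.symm y = e'.symm (e' (e.symm y)) := (e'.left_inv hy').symm
      _ = e'.symm y := by rw [← hy]

@[simp] theorem src_mk (e : OpenPartialHomeomorph M M) (he : e ∈ P) (x : M) (hx : x ∈ e.source) :
    (mk e he x hx).src = x := rfl

@[simp] theorem tgt_mk (e : OpenPartialHomeomorph M M) (he : e ∈ P) (x : M) (hx : x ∈ e.source) :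
    (mk e he x hx).tgt = e x := rfl

theorem inv_mk (e : OpenPartialHomeomorph M M) (he : e ∈ P) (x : M) (hx : x ∈ e.source) :
    (mk e he x hx).inv = mk e.symm (P.symm he) (e x) (e.map_source hx) := rfl

theorem exists_comp (h g : PseudogroupGerm P) (hg : h.src = g.tgt) :
    ∃ k : PseudogroupGerm P, ∀ e he x hx e' he' y hy,
      g = mk e he x hx → h = mk e' he' y hy →
        ∃ hx', k = mk (e ≫ₕ e') (P.trans he he') x hx' := by
  obtain ⟨e, he, x, hx, rfl⟩ := g.exists_mk
  obtain ⟨e', he', y, hy, rfl⟩ := h.exists_mk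
  simp only [src_mk, tgt_mk] at hg
  subst hg
  refine ⟨mk (e ≫ₕ e') (P.trans he he') x (by simp [hx, hy]), ?_⟩
  intro f hf x' hx' f' hf' y' hy' h₁ h₂
  obtain ⟨rfl, k₁⟩ := mk_eq_mk.mp h₁
  obtain ⟨rfl, k₂⟩ := mk_eq_mk.mp h₂
  have h₃ : e x = f x := k₁.eq_of_nhds
  refine ⟨by simp [hx', ← h₃, hy'], mk_eq_mk.mpr ⟨rfl, ?_⟩⟩
  have t : Filter.Tendsto e (𝓝 x) (𝓝 (e x)) := e.continuousAt hx
  filter_upwards [k₁, t.eventually k₂] with z hz hz'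
  simp only [OpenPartialHomeomorph.coe_trans, Function.comp_apply]
  rw [hz', hz]

/-- The composition of two germs: the germ of the composition of representatives. -/
noncomputable def comp (h g : PseudogroupGerm P) (hg : h.src = g.tgt) : PseudogroupGerm P :=
  (exists_comp h g hg).choose

theorem comp_mk (e e' : OpenPartialHomeomorph M M) (he : e ∈ P) (he' : e' ∈ P) (x y : M)
    (hx : x ∈ e.source) (hy : y ∈ e'.source) (hg : (mk e' he' y hy).src = (mk e he x hx).tgt) :
    ∃ hx', (mk e' he' y hy).comp (mk e he x hx) hg = mk (e ≫ₕ e') (P.trans he he') x hx' :=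
  (exists_comp (mk e' he' y hy) (mk e he x hx) hg).choose_spec _ _ _ _ _ _ _ _ rfl rfl

/-- The basic open set of the étale topology: the germs of `e` at the points of `s`. -/
def basicOpen (e : OpenPartialHomeomorph M M) (he : e ∈ P) (s : Set M) :
    Set (PseudogroupGerm P) :=
  {g | ∃ x hx, x ∈ s ∧ g = mk e he x hx}

/-- The étale topology on the space of germs. -/
instance : TopologicalSpace (PseudogroupGerm P) :=
  TopologicalSpace.generateFrom {O | ∃ e he s, IsOpen s ∧ O = basicOpen e he s}

theorem isOpen_basicOpen (e : OpenPartialHomeomorph M M) (he : e ∈ P) {s : Set M}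
    (hs : IsOpen s) : IsOpen (basicOpen e he s) :=
  TopologicalSpace.isOpen_generateFrom_of_mem ⟨e, he, s, hs, rfl⟩

theorem mk_mem_basicOpen (e : OpenPartialHomeomorph M M) (he : e ∈ P) {s : Set M} {x : M}
    (hx : x ∈ e.source) (hxs : x ∈ s) : mk e he x hx ∈ basicOpen e he s :=
  ⟨x, hx, hxs, rfl⟩

theorem continuous_src : Continuous (src : PseudogroupGerm P → M) := by
  refine continuous_def.mpr fun s hs => isOpen_iff_forall_mem_open.mpr fun g hg => ?_
  obtain ⟨e, he, x, hx, rfl⟩ := g.exists_mk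
  refine ⟨basicOpen e he s, ?_, isOpen_basicOpen e he hs, mk_mem_basicOpen e he hx hg⟩
  rintro _ ⟨y, hy, hys, rfl⟩
  exact hys

theorem continuous_inv : Continuous (inv : PseudogroupGerm P → PseudogroupGerm P) := by
  refine continuous_generateFrom_iff.mpr ?_
  rintro _ ⟨f, hf, s, hs, rfl⟩
  refine isOpen_iff_forall_mem_open.mpr ?_
  rintro g ⟨y, hy, hys, hg⟩
  obtain ⟨e, he, x, hx, rfl⟩ := g.exists_mk
  rw [inv_mk] at hg
  obtain ⟨rfl, hef⟩ := mk_eq_mk.mp hg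
  have t : Filter.Tendsto e (𝓝 x) (𝓝 (e x)) := e.continuousAt hx
  have ev : ∀ᶠ z in 𝓝 x, e.symm =ᶠ[𝓝 (e z)] f ∧ e z ∈ f.source ∧ e z ∈ s :=
    (t.eventually hef.eventually_nhds).and
      ((t.eventually (f.open_source.mem_nhds hy)).and (t.eventually (hs.mem_nhds hys)))
  obtain ⟨W, hW, hWo, hxW⟩ := eventually_nhds_iff.mp ev
  refine ⟨basicOpen e he W, ?_, isOpen_basicOpen e he hWo, mk_mem_basicOpen e he hx hxW⟩
  rintro _ ⟨z, hz, hzW, rfl⟩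
  obtain ⟨h₁, h₂, h₃⟩ := hW z hzW
  exact ⟨e z, h₂, h₃, by rw [inv_mk]; exact mk_eq_mk.mpr ⟨rfl, h₁⟩⟩

theorem src_inv (g : PseudogroupGerm P) : g.inv.src = g.tgt := by
  obtain ⟨e, he, x, hx, rfl⟩ := g.exists_mk
  rfl

theorem tgt_inv (g : PseudogroupGerm P) : g.inv.tgt = g.src := by
  obtain ⟨e, he, x, hx, rfl⟩ := g.exists_mk
  exact e.left_inv hx

theorem continuous_tgt : Continuous (tgt : PseudogroupGerm P → M) := by
  have : (tgt : PseudogroupGerm P → M) = src ∘ inv := funext fun g => (src_inv g).symm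
  rw [this]
  exact continuous_src.comp continuous_inv

theorem continuous_comp :
    Continuous fun p : {p : PseudogroupGerm P × PseudogroupGerm P // p.1.src = p.2.tgt} =>
      comp p.1.1 p.1.2 p.2 := by
  refine continuous_generateFrom_iff.mpr ?_
  rintro _ ⟨f, hf, s, hs, rfl⟩
  refine isOpen_iff_forall_mem_open.mpr ?_
  rintro ⟨⟨h, g⟩, hg⟩ ⟨y, hy, hys, hgf⟩
  obtain ⟨e, he, x, hx, rfl⟩ := g.exists_mk
  obtain ⟨e', he', x', hx', rfl⟩ := h.exists_mk
  obtain ⟨hc, hc'⟩ := comp_mk e e' he he' x x' hx hx' hg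
  replace hgf := hc'.symm.trans hgf
  obtain ⟨rfl, hef⟩ := mk_eq_mk.mp hgf
  have ev : ∀ᶠ z in 𝓝 x, ((e ≫ₕ e' : OpenPartialHomeomorph M M) =ᶠ[𝓝 z] f) ∧
      z ∈ f.source ∧ z ∈ s :=
    hef.eventually_nhds.and
      ((f.open_source.eventually_mem hy).and (hs.eventually_mem hys))
  obtain ⟨W, hW, hWo, hxW⟩ := eventually_nhds_iff.mp ev
  refine ⟨Subtype.val ⁻¹' (basicOpen e' he' Set.univ ×ˢ basicOpen e he W), ?_,
    ((isOpen_basicOpen e' he' isOpen_univ).prod (isOpen_basicOpen e he hWo)).preimage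
      continuous_subtype_val,
    ⟨mk_mem_basicOpen e' he' hx' trivial, mk_mem_basicOpen e he hx hxW⟩⟩
  rintro ⟨⟨_, _⟩, hz⟩ ⟨⟨z', hz', -, rfl⟩, ⟨z, hz₁, hzW, rfl⟩⟩
  obtain ⟨h₁, h₂, h₃⟩ := hW z hzW
  obtain ⟨hc₁, hc₂⟩ := comp_mk e e' he he' z z' hz₁ hz' hz
  exact ⟨z, h₂, h₃, hc₂.trans (mk_eq_mk.mpr ⟨rfl, h₁⟩)⟩

end PseudogroupGerm

open PseudogroupGerm in
/-- The topological groupoid of germs of the members of a pseudogroup, with the étale topology. -/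
noncomputable def germGroupoid (P : StructureGroupoid M) : TopologicalGroupoid M where
  Arr := PseudogroupGerm P
  src := src
  tgt := tgt
  comp := comp
  unit x := mk (OpenPartialHomeomorph.refl M) P.id_mem x trivial
  inv := inv
  src_comp h g hg := by
    obtain ⟨e, he, x, hx, rfl⟩ := g.exists_mk
    obtain ⟨e', he', x', hx', rfl⟩ := h.exists_mk
    obtain ⟨hc, hc'⟩ := comp_mk e e' he he' x x' hx hx' hg
    exact (congrArg src hc').trans (src_mk _ _ _ _)
  tgt_comp h g hg := by
    obtain ⟨e, he, x, hx, rfl⟩ := g.exists_mk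
    obtain ⟨e', he', x', hx', rfl⟩ := h.exists_mk
    obtain ⟨hc, hc'⟩ := comp_mk e e' he he' x x' hx hx' hg
    exact (congrArg tgt hc').trans (congrArg e' hg.symm)
  src_unit _ := rfl
  tgt_unit _ := rfl
  src_inv := src_inv
  tgt_inv := tgt_inv
  assoc k h g hkh hhg := by
    obtain ⟨e, he, x, hx, rfl⟩ := g.exists_mk
    obtain ⟨e', he', x', hx', rfl⟩ := h.exists_mk
    obtain ⟨e'', he'', x'', hx'', rfl⟩ := k.exists_mk
    obtain ⟨a₁, b₁⟩ := comp_mk e e' he he' x x' hx hx' hhg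
    obtain ⟨a₂, b₂⟩ := comp_mk e' e'' he' he'' x' x'' hx' hx'' hkh
    simp only [b₁, b₂]
    obtain ⟨a₃, b₃⟩ := comp_mk (e ≫ₕ e') e'' (P.trans he he') he'' x x'' a₁ hx''
      (hkh.trans (congrArg e' hhg))
    obtain ⟨a₄, b₄⟩ := comp_mk e (e' ≫ₕ e'') he (P.trans he' he'') x x' hx a₂ hhg
    rw [b₃, b₄]
    exact mk_eq_mk.mpr ⟨rfl, by rw [OpenPartialHomeomorph.trans_assoc]⟩
  unit_comp g := by
    obtain ⟨e, he, x, hx, rfl⟩ := g.exists_mk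
    obtain ⟨hc, hc'⟩ := comp_mk e (OpenPartialHomeomorph.refl M) he P.id_mem x (e x) hx trivial rfl
    exact hc'.trans (mk_eq_mk.mpr ⟨rfl, by simp⟩)
  comp_unit g := by
    obtain ⟨e, he, x, hx, rfl⟩ := g.exists_mk
    obtain ⟨hc, hc'⟩ := comp_mk (OpenPartialHomeomorph.refl M) e P.id_mem he x x trivial hx rfl
    exact hc'.trans (mk_eq_mk.mpr ⟨rfl, by simp⟩)
  inv_comp g := by
    obtain ⟨e, he, x, hx, rfl⟩ := g.exists_mk
    obtain ⟨hc, hc'⟩ := comp_mk e e.symm he (P.symm he) x (e x) hx (e.map_source hx) rfl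
    refine hc'.trans (mk_eq_mk.mpr ⟨rfl, ?_⟩)
    filter_upwards [e.open_source.mem_nhds hx] with z hz
    simpa using e.left_inv hz
  comp_inv g := by
    obtain ⟨e, he, x, hx, rfl⟩ := g.exists_mk
    obtain ⟨hc, hc'⟩ := comp_mk e.symm e (P.symm he) he (e x) x (e.map_source hx) hx
      (e.left_inv hx).symm
    refine hc'.trans (mk_eq_mk.mpr ⟨rfl, ?_⟩)
    filter_upwards [e.open_target.mem_nhds (e.map_source hx)] with z hz
    simpa using e.right_inv hz
  continuous_src := continuous_src
  continuous_tgt := continuous_tgt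
  continuous_unit := by
    refine continuous_generateFrom_iff.mpr ?_
    rintro _ ⟨f, hf, s, hs, rfl⟩
    refine isOpen_iff_forall_mem_open.mpr ?_
    rintro x ⟨y, hy, hys, hg⟩
    obtain ⟨rfl, hef⟩ := mk_eq_mk.mp hg
    have ev : ∀ᶠ z in 𝓝 x, ((OpenPartialHomeomorph.refl M : OpenPartialHomeomorph M M) =ᶠ[𝓝 z] f) ∧
        z ∈ f.source ∧ z ∈ s :=
      hef.eventually_nhds.and
      ((f.open_source.eventually_mem hy).and (hs.eventually_mem hys))
    obtain ⟨W, hW, hWo, hxW⟩ := eventually_nhds_iff.mp ev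
    refine ⟨W, fun z hz => ?_, hWo, hxW⟩
    obtain ⟨h₁, h₂, h₃⟩ := hW z hz
    exact ⟨z, h₂, h₃, mk_eq_mk.mpr ⟨rfl, h₁⟩⟩
  continuous_inv := continuous_inv
  continuous_comp := continuous_comp

/-- The pseudogroup generated by a set of open partial homeomorphisms. -/
def generatedPseudogroup (S : Set (OpenPartialHomeomorph M M)) : StructureGroupoid M :=
  sInf {P | ClosedUnderRestriction P ∧ ∀ e ∈ S, e ∈ P}

end Germs

/-! ### Orbifolds -/

/-- Self-homeomorphisms act by evaluation. -/
instance homeomorphMulAction (Y : Type*) [TopologicalSpace Y] : MulAction (Y ≃ₜ Y) Y where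
  smul g y := g y
  one_smul _ := rfl
  mul_smul _ _ _ := rfl

instance homeomorphContinuousConstSMul (Y : Type*) [TopologicalSpace Y] :
    ContinuousConstSMul (Y ≃ₜ Y) Y where
  continuous_const_smul g := g.continuous

instance subgroupHomeomorphContinuousConstSMul {Y : Type*} [TopologicalSpace Y]
    (G : Subgroup (Y ≃ₜ Y)) : ContinuousConstSMul G Y where
  continuous_const_smul g := g.1.continuous

/-- The stabilizer of a subset acts continuously on it. -/
instance stabilizerContinuousConstSMul {Y G : Type*} [TopologicalSpace Y] [Group G] [MulAction G Y]
    [ContinuousConstSMul G Y] (S : Set Y) :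
    ContinuousConstSMul (MulAction.stabilizer G S) S where
  continuous_const_smul g :=
    ((continuous_const_smul (g : G)).comp continuous_subtype_val).subtype_mk _

/-- An `n`-dimensional orbifold structure on `X`, in the sense of Satake and Kawasaki: a cover of
`X` by open sets `U i`, with uniformizing systems `(Û i, G i, π i)` where `Û i` is a connected open
subset of `ℝⁿ` and `G i` is a finite group of self-diffeomorphisms of `Û i`, and with a set
`inj j i` of injections `Û j → Û i` whenever `U j ⊆ U i`. -/
structure SatakeOrbifold (n : ℕ) (X : Type u) [TopologicalSpace X] (I : Type v) where
  U : I → TopologicalSpace.Opens X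
  cover : ∀ p, ∃ i, p ∈ U i
  dom : I → TopologicalSpace.Opens (EuclideanSpace ℝ (Fin n))
  connected : ∀ i, IsConnected (dom i : Set (EuclideanSpace ℝ (Fin n)))
  G : ∀ i, Subgroup (dom i ≃ₜ dom i)
  finite : ∀ i, Finite (G i)
  smooth : ∀ i, ∀ g ∈ G i, ContMDiff 𝓘(ℝ, EuclideanSpace ℝ (Fin n))
    𝓘(ℝ, EuclideanSpace ℝ (Fin n)) ∞ g
  π : ∀ i, dom i → X
  uniformizes : ∀ i, InducesHomeomorph (G i) (π i) (U i : Set X)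
  inj : ∀ j i, U j ≤ U i → Set (dom j → dom i)
  /-- Each injection is a smooth open embedding over `X`. -/
  inj_isOpenEmbedding : ∀ j i h, ∀ φ ∈ inj j i h, Topology.IsOpenEmbedding φ
  inj_smooth : ∀ j i h, ∀ φ ∈ inj j i h, IsLocalDiffeomorph 𝓘(ℝ, EuclideanSpace ℝ (Fin n))
    𝓘(ℝ, EuclideanSpace ℝ (Fin n)) ∞ φ
  π_inj : ∀ j i h, ∀ φ ∈ inj j i h, ∀ x, π i (φ x) = π j x
  /-- `G i` acts on the injections into `Û i`, freely and transitively, by post-composition. -/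
  inj_nonempty : ∀ j i h, (inj j i h).Nonempty
  inj_smul : ∀ j i h, ∀ φ ∈ inj j i h, ∀ g ∈ G i, (fun x => g (φ x)) ∈ inj j i h
  inj_free : ∀ j i h, ∀ φ ∈ inj j i h, ∀ g ∈ G i, (∀ x, g (φ x) = φ x) → g = 1
  inj_transitive : ∀ j i h, ∀ φ ∈ inj j i h, ∀ ψ ∈ inj j i h, ∃ g ∈ G i, ∀ x, ψ x = g (φ x)
  inj_comp : ∀ k j i hkj hji, ∀ φ ∈ inj k j hkj, ∀ ψ ∈ inj j i hji,
    (fun x => ψ (φ x)) ∈ inj k i (hkj.trans hji)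
  /-- Every point of `U i ∩ U j` lies in some `U k ⊆ U i ∩ U j`. -/
  directed : ∀ i j, ∀ p ∈ U i ⊓ U j, ∃ k, p ∈ U k ∧ U k ≤ U i ⊓ U j

namespace SatakeOrbifold

variable {n : ℕ} {X : Type u} [TopologicalSpace X] {I : Type v}

/-- The injections, as open partial homeomorphisms of the disjoint union of all the `Û i`. -/
def injections (O : SatakeOrbifold n X I) :
    Set (OpenPartialHomeomorph (Σ i, O.dom i) (Σ i, O.dom i)) :=
  {e | ∃ j i h, ∃ φ ∈ O.inj j i h, e.source = Set.range (Sigma.mk j) ∧ ∀ x, e ⟨j, x⟩ = ⟨i, φ x⟩}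

/-- The étale topological groupoid associated with an orbifold: the germs of the pseudogroup
generated by the injections. -/
noncomputable def groupoid (O : SatakeOrbifold n X I) : TopologicalGroupoid (Σ i, O.dom i) :=
  germGroupoid (generatedPseudogroup O.injections)

/-- The natural map from the disjoint union of subsets `S a ⊆ Û (i a)` to that of the `Û i`. -/
def sheetMap (O : SatakeOrbifold n X I) {A : Type w} (i : A → I) (S : ∀ a, Set (O.dom (i a))) :
    (Σ a, S a) → Σ i, O.dom i :=
  fun x => ⟨i x.1, x.2.1⟩

theorem continuous_sheetMap (O : SatakeOrbifold n X I) {A : Type w} (i : A → I)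
    (S : ∀ a, Set (O.dom (i a))) : Continuous (O.sheetMap i S) :=
  continuous_sigma fun a =>
    (continuous_sigmaMk (σ := fun j => O.dom j) (i := i a)).comp continuous_subtype_val

end SatakeOrbifold

/-! The engine is rigidity: an element of a chart group that is the identity near one point is the
identity (`eq_one_of_eventually`). It holds because the groups are finite and the charts connected:
where a finite order map has a fixed point with identity derivative, averaging its iterates shows
that it is the identity nearby, so the interior of the fixed set is closed in the chart.

With a Baire argument, rigidity shows that a translate `h ∘ φ` of an injection whose image meets
that of `φ` is a reparametrization `φ ∘ g` (`exists_comp_eq`). Hence two injections with a common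
value factor through a common one (`exists_common_factor`), and local maps of the form `ψ ∘ φ⁻¹` are
closed under composition. Every arrow of the groupoid is therefore a germ of such a span, and it can
be represented over any injection that comes from a chart contained in both charts and passes
through its source (`exists_eq_spanGerm`). Applied inside one chart, this says that arrows are germs
of group elements; rigidity makes the element unique and the space of arrows Hausdorff.

By paracompactness there is a cover by sets `V a`, images of connected open subsets of charts, such
that whenever `V a` meets `V b` a single `U l`, contained in both `U (i a)` and `U (i b)`, contains
`V a ∩ V b` (`exists_good_cover`). The full preimage of `V a` and each of its components share the
properties recorded in `IsSheet`, which are all that the rest of the proof uses of them. The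
equivalence and the orbispace structure then follow from the description of arrows, and (C1) holds
because arrows are étale over locally Euclidean units.

For (C2), write an arrow from sheet `a` to sheet `b` as a germ of `ψ ∘ φ⁻¹` over `U l`. The
component of the source image through its source is connected and lies over `U l`, so it cannot
leave the image of `φ` (`subset_range_inj`). Thus `ψ ∘ φ⁻¹` is defined along all of it, and its
germs form a section of the source map. Uniqueness of lifts in a Hausdorff space identifies the
component of arrows with the image of this section; inversion handles the target map. -/

/-! ### Finite order diffeomorphisms are determined by their restriction to an open set -/

/-- A `C¹` map of finite order is the identity near a fixed point where its derivative is the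
identity: the average of its iterates is invariant and injective near that point. -/
theorem eventually_eq_self_of_hasFDerivAt_id {E : Type*} [NormedAddCommGroup E] [NormedSpace ℝ E]
    [CompleteSpace E] {f : E → E} {D : Set E} (hD : IsOpen D) {N : ℕ} (hN : N ≠ 0)
    (hfN : ∀ y ∈ D, f^[N] y = y) {z : E} (hz : z ∈ D) (hfz : f z = z)
    (hf : ContDiffAt ℝ 1 f z) (hf' : HasFDerivAt f (ContinuousLinearMap.id ℝ E) z) :
    ∀ᶠ y in 𝓝 z, f y = y := by
  have hs : HasStrictFDerivAt f (ContinuousLinearMap.id ℝ E) z :=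
    hf.hasStrictFDerivAt' hf' one_ne_zero
  set h : E → E := fun y => (N : ℝ)⁻¹ • ∑ j ∈ Finset.range N, f^[j] y with hh
  have hN' : (N : ℝ) ≠ 0 := Nat.cast_ne_zero.mpr hN
  -- Each iterate has derivative `id` at the fixed point `z`, hence so does their average; the
  -- inverse function theorem then makes `h` injective near `z`.
  have hd : HasStrictFDerivAt h ((ContinuousLinearEquiv.refl ℝ E : E ≃L[ℝ] E) : E →L[ℝ] E) z := by
    have h₁ : HasStrictFDerivAt h ((N : ℝ)⁻¹ • ∑ j ∈ Finset.range N,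
        (ContinuousLinearMap.id ℝ E) ^ j) z :=
      (HasStrictFDerivAt.fun_sum fun j _ => hs.iterate hfz j).const_smul _
    convert h₁ using 1
    ext y
    have : ∀ j, (ContinuousLinearMap.id ℝ E) ^ j = ContinuousLinearMap.id ℝ E := fun j => one_pow j
    simp only [this, Finset.sum_const, Finset.card_range, smul_apply,
      ContinuousLinearMap.id_apply, ContinuousLinearEquiv.coe_coe, ContinuousLinearEquiv.refl_apply]
    rw [← Nat.cast_smul_eq_nsmul ℝ, smul_smul, inv_mul_cancel₀ hN', one_smul]
  -- Replacing `y` by `f y` shifts the sum by one index; the first and last terms agree because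
  -- `f^[N] y = y`.
  have hinv : ∀ y ∈ D, h (f y) = h y := by
    intro y hy
    simp only [hh, ← Function.iterate_succ_apply]
    congr 1
    have h₁ := Finset.sum_range_succ (fun j => f^[j] y) N
    rw [Finset.sum_range_succ', hfN y hy] at h₁
    simpa using h₁
  let e := hd.toOpenPartialHomeomorph h
  have hes : e.source ∈ 𝓝 z := e.open_source.mem_nhds hd.mem_toOpenPartialHomeomorph_source
  have t : Filter.Tendsto f (𝓝 z) (𝓝 z) := by
    have := hf.continuousAt.tendsto
    rwa [hfz] at this
  filter_upwards [hes, t.eventually hes, hD.mem_nhds hz] with y h₁ h₂ h₃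
  exact e.injOn h₂ h₁ (hinv y h₃)

/-- A diffeomorphism of finite order of a connected open set is the identity as soon as it fixes
the points of a non-empty open subset. -/
theorem Homeomorph.eq_one_of_eqOn_isOpen {E : Type*} [NormedAddCommGroup E] [NormedSpace ℝ E]
    [CompleteSpace E] {D : TopologicalSpace.Opens E} (hD : IsPreconnected (D : Set E))
    (g : D ≃ₜ D) (hg : ContMDiff 𝓘(ℝ, E) 𝓘(ℝ, E) ∞ g) (hfin : IsOfFinOrder g)
    {x₀ : D} (hx₀ : ∀ᶠ x in 𝓝 x₀, g x = x) : g = 1 := by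
  classical
  obtain ⟨N, hN, hgN⟩ := isOfFinOrder_iff_pow_eq_one.mp hfin
  -- Extension to all of `E`, so that ordinary derivatives apply; the value outside `D` plays no
  -- role.
  set f : E → E := fun x => if h : x ∈ D then g ⟨x, h⟩ else x with hfdef
  have hfg : ∀ x : D, f x = g x := fun x => by simp [hfdef]
  have hcd : ∀ x ∈ D, ContDiffAt ℝ 1 f x := by
    intro x hx
    have h₁ : ContMDiffAt 𝓘(ℝ, E) 𝓘(ℝ, E) ∞ (fun y : D => f y) (⟨x, hx⟩ : D) := by
      simp only [hfg]
      exact contMDiff_subtype_val.contMDiffAt.comp _ hg.contMDiffAt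
    exact (contMDiffAt_subtype_iff.mp h₁).contDiffAt.of_le (by simp)
  have hiter : ∀ k (x : D), f^[k] x = ((g ^ k : D ≃ₜ D) x : E) := by
    intro k
    induction k with
    | zero => intro x; rfl
    | succ k ih =>
      intro x
      rw [Function.iterate_succ_apply, hfg, ih, pow_succ]
      rfl
  have hfN : ∀ y ∈ (D : Set E), f^[N] y = y := fun y hy => by
    rw [hiter N ⟨y, hy⟩, hgN]; rfl
  let Z : Set E := interior {x | f x = x}
  -- `Z` is closed relative to `D`: both `f z = z` and `fderiv ℝ f z = id` pass to limits of points
  -- of `Z`, and the preceding theorem then applies at `z`.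
  have hZ : ∀ z ∈ closure Z, z ∈ D → z ∈ Z := by
    intro z hz hzD
    have hev : ∀ y ∈ Z, f y = y ∧ fderiv ℝ f y = ContinuousLinearMap.id ℝ E := by
      intro y hy
      have : f =ᶠ[𝓝 y] id := mem_interior_iff_mem_nhds.mp hy
      exact ⟨this.eq_of_nhds, by rw [this.fderiv_eq, fderiv_id]⟩
    have hne : (𝓝[Z] z).NeBot := mem_closure_iff_nhdsWithin_neBot.mp hz
    have hfz : f z = z := tendsto_nhds_unique
      ((hcd z hzD).continuousAt.tendsto.mono_left (nhdsWithin_le_nhds (s := Z)))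
      ((continuousAt_id.tendsto.mono_left nhdsWithin_le_nhds).congr' (by
        filter_upwards [self_mem_nhdsWithin] with y hy using (hev y hy).1.symm))
    have hfz' : fderiv ℝ f z = ContinuousLinearMap.id ℝ E := tendsto_nhds_unique
      (((hcd z hzD).fderiv_right (m := 0) (by simp)).continuousAt.tendsto.mono_left
        (nhdsWithin_le_nhds (s := Z)))
      (tendsto_const_nhds.congr' (by
        filter_upwards [self_mem_nhdsWithin] with y hy using (hev y hy).2.symm))
    refine mem_interior_iff_mem_nhds.mpr ?_
    refine eventually_eq_self_of_hasFDerivAt_id D.2 hN.ne' hfN hzD hfz (hcd z hzD) ?_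
    rw [← hfz']
    exact ((hcd z hzD).differentiableAt one_ne_zero).hasFDerivAt
  have hx₀Z : (x₀ : E) ∈ Z := by
    rw [mem_interior_iff_mem_nhds, ← D.2.isOpenEmbedding_subtypeVal.map_nhds_eq]
    refine Filter.mem_map.mpr ?_
    filter_upwards [hx₀] with x hx
    simp [hfg, hx]
  have hsub : (D : Set E) ⊆ Z := by
    refine hD.subset_left_of_subset_union isOpen_interior isClosed_closure.isOpen_compl
      (Set.disjoint_compl_right_iff_subset.mpr subset_closure) ?_ ⟨x₀, x₀.2, hx₀Z⟩
    intro z hz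
    by_cases h : z ∈ closure Z
    · exact Or.inl (hZ z h hz)
    · exact Or.inr h
  ext x
  have := interior_subset (hsub x.2)
  rw [Set.mem_ofPred_eq, hfg] at this
  exact this

/-! ### Finite quotients -/

section InducesHomeomorph

variable {X Y G : Type*} [TopologicalSpace X] [TopologicalSpace Y] [Group G] [MulAction G Y]
  {π : Y → X} {V : Set X}

theorem InducesHomeomorph.eq_iff (h : InducesHomeomorph G π V) {x y : Y} :
    π x = π y ↔ ∃ g : G, g • x = y := by
  obtain ⟨h, hh⟩ := h
  rw [← hh, ← hh, SetCoe.ext_iff, h.injective.eq_iff, Quotient.eq, MulAction.orbitRel_apply,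
    MulAction.mem_orbit_iff]
  exact ⟨fun ⟨g, hg⟩ => ⟨g⁻¹, by rw [← hg, inv_smul_smul]⟩,
    fun ⟨g, hg⟩ => ⟨g⁻¹, by rw [← hg, inv_smul_smul]⟩⟩

theorem InducesHomeomorph.continuous (h : InducesHomeomorph G π V) : Continuous π := by
  obtain ⟨h, hh⟩ := h
  have : π = fun y => (h (Quotient.mk _ y) : X) := funext fun y => (hh y).symm
  rw [this]
  exact continuous_subtype_val.comp (h.continuous.comp continuous_quotient_mk')

theorem InducesHomeomorph.isOpenMap [ContinuousConstSMul G Y] (h : InducesHomeomorph G π V)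
    (hV : IsOpen V) : IsOpenMap π := by
  obtain ⟨h, hh⟩ := h
  have : π = fun y => (h (Quotient.mk _ y) : X) := funext fun y => (hh y).symm
  rw [this]
  exact hV.isOpenMap_subtype_val.comp (h.isOpenMap.comp isOpenMap_quotient_mk'_mul)

theorem InducesHomeomorph.mem (h : InducesHomeomorph G π V) (y : Y) : π y ∈ V := by
  obtain ⟨h, hh⟩ := h
  rw [← hh]
  exact Subtype.coe_prop _

theorem InducesHomeomorph.exists_eq (h : InducesHomeomorph G π V) {p : X} (hp : p ∈ V) :
    ∃ y, π y = p := by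
  obtain ⟨h, hh⟩ := h
  obtain ⟨q, hq⟩ := h.surjective ⟨p, hp⟩
  obtain ⟨y, rfl⟩ := Quotient.exists_rep q
  exact ⟨y, by rw [← hh, hq]⟩

theorem exists_homeomorph_quotient {s : Setoid Y} (hc : Continuous π) (ho : IsOpenMap π)
    (hV : Set.range π = V) (hπ : ∀ x y, s x y ↔ π x = π y) :
    ∃ h : Quotient s ≃ₜ V, ∀ y, (h (Quotient.mk _ y) : X) = π y := by
  have hmem : ∀ y, π y ∈ V := fun y => hV ▸ Set.mem_range_self y
  let F : Quotient s → V :=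
    Quotient.lift (fun y => ⟨π y, hmem y⟩) fun x y hxy => Subtype.ext ((hπ x y).mp hxy)
  have hF : Function.Bijective F := by
    constructor
    · rintro ⟨x⟩ ⟨y⟩ hxy
      exact Quotient.sound ((hπ x y).mpr (congrArg Subtype.val hxy))
    · rintro ⟨p, hp⟩
      rw [← hV] at hp
      obtain ⟨y, rfl⟩ := hp
      exact ⟨Quotient.mk _ y, rfl⟩
  have hFc : Continuous F := (hc.subtype_mk hmem).quotient_lift _
  have hFo : IsOpenMap F := by
    intro t ht
    refine ⟨_, ho _ (ht.preimage continuous_quotient_mk'), ?_⟩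
    ext ⟨p, hp⟩
    constructor
    · rintro ⟨y, hy, hyp⟩
      exact ⟨_, hy, Subtype.ext hyp⟩
    · rintro ⟨⟨y⟩, hy, hyp⟩
      exact ⟨y, hy, congrArg Subtype.val hyp⟩
  exact ⟨(Equiv.ofBijective F hF).toHomeomorphOfContinuousOpen hFc hFo, fun y => rfl⟩

theorem inducesHomeomorph_of_isOpenMap (hc : Continuous π) (ho : IsOpenMap π)
    (hV : Set.range π = V) (hπ : ∀ x y, π x = π y ↔ ∃ g : G, g • x = y) :
    InducesHomeomorph G π V :=
  exists_homeomorph_quotient hc ho hV fun x y => by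
    rw [eq_comm, hπ, MulAction.orbitRel_apply, MulAction.mem_orbit_iff]

end InducesHomeomorph

/-! ### Injections of an orbifold -/

namespace SatakeOrbifold

variable {n : ℕ} {X : Type u} [TopologicalSpace X] {I : Type v} (O : SatakeOrbifold n X I)

theorem π_eq_iff {i : I} {x y : O.dom i} : O.π i x = O.π i y ↔ ∃ g ∈ O.G i, g x = y := by
  rw [(O.uniformizes i).eq_iff]
  exact ⟨fun ⟨g, hg⟩ => ⟨g.1, g.2, hg⟩, fun ⟨g, hg, h⟩ => ⟨⟨g, hg⟩, h⟩⟩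

theorem continuous_π (i : I) : Continuous (O.π i) := (O.uniformizes i).continuous

theorem isOpenMap_π (i : I) : IsOpenMap (O.π i) := (O.uniformizes i).isOpenMap (O.U i).2

theorem π_mem {i : I} (x : O.dom i) : O.π i x ∈ O.U i := (O.uniformizes i).mem x

theorem exists_π_eq {i : I} {p : X} (hp : p ∈ O.U i) : ∃ x, O.π i x = p :=
  (O.uniformizes i).exists_eq hp

theorem π_apply {i : I} {g : O.dom i ≃ₜ O.dom i} (hg : g ∈ O.G i) (x : O.dom i) :
    O.π i (g x) = O.π i x :=
  (O.π_eq_iff.mpr ⟨g, hg, rfl⟩).symm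

theorem nonempty_dom (i : I) : Nonempty (O.dom i) := (O.connected i).nonempty.to_subtype

theorem eq_one_of_eventually {i : I} {g : O.dom i ≃ₜ O.dom i} (hg : g ∈ O.G i) {x : O.dom i}
    (hx : ∀ᶠ y in 𝓝 x, g y = y) : g = 1 := by
  have := O.finite i
  refine Homeomorph.eq_one_of_eqOn_isOpen (O.connected i).isPreconnected g (O.smooth i g hg) ?_ hx
  have h : IsOfFinOrder (⟨g, hg⟩ : O.G i) := isOfFinOrder_of_finite _
  exact (O.G i).subtype.isOfFinOrder h

theorem injective_inj {j i : I} {h : O.U j ≤ O.U i} {φ} (hφ : φ ∈ O.inj j i h) :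
    Function.Injective φ :=
  (O.inj_isOpenEmbedding j i h φ hφ).injective

theorem continuous_inj {j i : I} {h : O.U j ≤ O.U i} {φ} (hφ : φ ∈ O.inj j i h) :
    Continuous φ :=
  (O.inj_isOpenEmbedding j i h φ hφ).continuous

/-- The axioms give the identity only indirectly. Since `φ ∘ φ = a ∘ φ`, the injection `ψ = a⁻¹ ∘ φ`
fixes the image of `φ` pointwise. Writing `ψ ∘ ψ = b ∘ ψ` and evaluating on that image, freeness
forces `b = 1`; an injective idempotent map is the identity. -/
theorem id_mem_inj (i : I) : id ∈ O.inj i i le_rfl := by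
  obtain ⟨φ, hφ⟩ := O.inj_nonempty i i le_rfl
  obtain ⟨a, ha, haφ⟩ := O.inj_transitive i i le_rfl φ hφ _ (O.inj_comp i i i _ _ φ hφ φ hφ)
  set ψ : O.dom i → O.dom i := fun x => a⁻¹ (φ x) with hψ
  have hψ' : ψ ∈ O.inj i i le_rfl := O.inj_smul i i _ φ hφ _ ((O.G i).inv_mem ha)
  have hψφ : ∀ x, ψ (φ x) = φ x := fun x => by
    change a.symm (φ (φ x)) = φ x
    rw [haφ, a.symm_apply_apply]
  obtain ⟨b, hb, hbψ⟩ := O.inj_transitive i i le_rfl ψ hψ' _ (O.inj_comp i i i _ _ ψ hψ' ψ hψ')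
  have hb1 : b = 1 := O.inj_free i i le_rfl φ hφ b hb fun x => by
    have := hbψ (φ x)
    rwa [hψφ, hψφ, eq_comm] at this
  have : ψ = id := funext fun x => O.injective_inj hψ' (by rw [hbψ x, hb1]; rfl)
  exact this ▸ hψ'

theorem group_mem_inj {i : I} {g : O.dom i ≃ₜ O.dom i} (hg : g ∈ O.G i) :
    (fun x => g x) ∈ O.inj i i le_rfl :=
  O.inj_smul i i _ _ (O.id_mem_inj i) g hg

theorem exists_inj_apply_eq {j i : I} (h : O.U j ≤ O.U i) {w : O.dom j} {x : O.dom i}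
    (hwx : O.π j w = O.π i x) : ∃ φ ∈ O.inj j i h, φ w = x := by
  obtain ⟨φ, hφ⟩ := O.inj_nonempty j i h
  obtain ⟨g, hg, hgx⟩ := O.π_eq_iff.mp ((O.π_inj j i h φ hφ w).trans hwx)
  exact ⟨_, O.inj_smul j i h φ hφ g hg, hgx⟩

/-- If two translates of the image of an injection meet, they differ by a reparametrization. -/
theorem exists_comp_eq {k i : I} {hki : O.U k ≤ O.U i} {φ} (hφ : φ ∈ O.inj k i hki)
    {h : O.dom i ≃ₜ O.dom i} (hh : h ∈ O.G i) {w₁ w₂ : O.dom k} (hw : h (φ w₁) = φ w₂) :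
    ∃ g ∈ O.G k, ∀ w, h (φ w) = φ (g w) := by
  have := O.finite k
  have hφo := O.inj_isOpenEmbedding k i hki φ hφ
  let T : Set (O.dom k) := {w | h (φ w) ∈ Set.range φ}
  have hT : IsOpen T := hφo.isOpen_range.preimage (h.continuous.comp hφo.continuous)
  have hTne : T.Nonempty := ⟨w₁, w₂, hw.symm⟩
  let F : O.G k → Set (O.dom k) := fun g => {w | h (φ w) = φ (g.1 w)}
  have hF : ∀ g, IsClosed (F g) := fun g =>
    isClosed_eq (h.continuous.comp hφo.continuous) (hφo.continuous.comp g.1.continuous)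
  have hTF : T ⊆ ⋃ g, F g := by
    rintro w ⟨w', hw'⟩
    have : O.π k w = O.π k w' := by
      rw [← O.π_inj k i hki φ hφ w, ← O.π_inj k i hki φ hφ w', hw', O.π_apply hh]
    obtain ⟨g, hg, rfl⟩ := O.π_eq_iff.mp this
    exact Set.mem_iUnion.mpr ⟨⟨g, hg⟩, hw'.symm⟩
  -- The non-empty open set `T` is a Baire space covered by finitely many closed sets `F g`, so one
  -- of them has interior.
  obtain ⟨g, w, hw⟩ : ∃ g, (interior (F g)).Nonempty := by
    have hlc : LocallyCompactSpace (O.dom k) := (O.dom k).2.locallyCompactSpace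
    have : BaireSpace T := hT.baireSpace
    have : Nonempty T := hTne.to_subtype
    obtain ⟨g, w, hw⟩ := nonempty_interior_of_iUnion_of_closed
      (f := fun g => (Subtype.val ⁻¹' F g : Set T))
      (fun g => (hF g).preimage continuous_subtype_val) (by
        rw [← Set.preimage_iUnion, Set.eq_univ_iff_forall]
        exact fun w => hTF w.2)
    refine ⟨g, w, ?_⟩
    rw [← hT.isOpenMap_subtype_val.preimage_interior_eq_interior_preimage
      continuous_subtype_val] at hw
    exact hw
  refine ⟨g, g.2, ?_⟩
  -- Both `h ∘ φ` and `φ ∘ g` are injections, so they differ by some `a` in `G i`; as they agree on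
  -- an open set, `a` is locally the identity, and rigidity gives `a = 1`.
  have h₁ : (fun w => φ (g.1 w)) ∈ O.inj k i hki :=
    O.inj_comp k k i le_rfl hki _ (O.group_mem_inj g.2) φ hφ
  obtain ⟨a, ha, haφ⟩ := O.inj_transitive k i hki _ (O.inj_smul k i hki φ hφ h hh) _ h₁
  have ha1 : a = 1 := by
    refine O.eq_one_of_eventually ha (x := h (φ w)) ?_
    have h₂ := (O.inj_isOpenEmbedding k i hki _ (O.inj_smul k i hki φ hφ h hh)).map_nhds_eq w
    rw [← h₂, Filter.eventually_map]
    filter_upwards [mem_interior_iff_mem_nhds.mp hw] with w' hw'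
    rw [← haφ w']
    exact hw'.symm
  intro w
  rw [haφ w, ha1]
  rfl

/-- Two injections with a common value factor, near that value, through the same injection. -/
theorem exists_common_factor {k l i : I} {hki : O.U k ≤ O.U i} {hli : O.U l ≤ O.U i} {φ φ'}
    (hφ : φ ∈ O.inj k i hki) (hφ' : φ' ∈ O.inj l i hli) {w : O.dom k} {w' : O.dom l}
    (hw : φ w = φ' w') :
    ∃ (m : I) (hmk : O.U m ≤ O.U k) (hml : O.U m ≤ O.U l), ∃ θ ∈ O.inj m k hmk,
      ∃ θ' ∈ O.inj m l hml, ∃ v, θ v = w ∧ θ' v = w' ∧ ∀ v, φ (θ v) = φ' (θ' v) := by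
  have hp : O.π k w = O.π l w' := by
    rw [← O.π_inj k i hki φ hφ w, ← O.π_inj l i hli φ' hφ' w', hw]
  obtain ⟨m, hm, hmle⟩ := O.directed k l (O.π k w) ⟨O.π_mem w, hp ▸ O.π_mem w'⟩
  obtain ⟨v, hv⟩ := O.exists_π_eq hm
  have hmk := hmle.trans inf_le_left
  have hml := hmle.trans inf_le_right
  obtain ⟨θ, hθ, rfl⟩ := O.exists_inj_apply_eq hmk hv
  obtain ⟨θ', hθ', rfl⟩ := O.exists_inj_apply_eq hml (hv.trans hp)
  -- The two composites agree up to some `h` in `G i`. At `v` the map `h` sends one point of the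
  -- image of `φ'` to another, so `h ∘ φ' = φ' ∘ g`, and `θ'` is replaced by `g ∘ θ'`.
  obtain ⟨h, hh, hhφ⟩ := O.inj_transitive m i (hml.trans hli) _
    (O.inj_comp m l i hml hli θ' hθ' φ' hφ') _ (O.inj_comp m k i hmk hki θ hθ φ hφ)
  obtain ⟨g, hg, hgφ⟩ := O.exists_comp_eq hφ' hh ((hhφ v).symm.trans hw)
  have key : ∀ v, φ (θ v) = φ' (g (θ' v)) := fun v => (hhφ v).trans (hgφ _)
  exact ⟨m, hmk, hml, θ, hθ, _, O.inj_smul m l hml θ' hθ' g hg, v, rfl,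
    O.injective_inj hφ' ((key v).symm.trans hw), key⟩

end SatakeOrbifold

/-! ### The étale topology on germs -/

namespace PseudogroupGerm

variable {M : Type u} [TopologicalSpace M] {P : StructureGroupoid M}

theorem continuous_mk (e : OpenPartialHomeomorph M M) (he : e ∈ P) :
    Continuous fun x : e.source => mk e he x x.2 := by
  refine continuous_generateFrom_iff.mpr ?_
  rintro _ ⟨f, hf, s, hs, rfl⟩
  refine isOpen_iff_forall_mem_open.mpr ?_
  rintro ⟨x, hx⟩ ⟨y, hy, hys, hg⟩
  obtain ⟨rfl, hef⟩ := mk_eq_mk.mp hg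
  have ev : ∀ᶠ z in 𝓝 x, e =ᶠ[𝓝 z] f ∧ z ∈ f.source ∧ z ∈ s :=
    hef.eventually_nhds.and ((f.open_source.eventually_mem hy).and (hs.eventually_mem hys))
  obtain ⟨W, hW, hWo, hxW⟩ := eventually_nhds_iff.mp ev
  refine ⟨Subtype.val ⁻¹' W, ?_, hWo.preimage continuous_subtype_val, hxW⟩
  rintro ⟨z, hz⟩ hzW
  obtain ⟨h₁, h₂, h₃⟩ := hW z hzW
  exact ⟨z, h₂, h₃, mk_eq_mk.mpr ⟨rfl, h₁⟩⟩

theorem isLocalHomeomorph_src : IsLocalHomeomorph (src : PseudogroupGerm P → M) := by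
  classical
  refine IsLocalHomeomorph.mk _ fun g => ?_
  obtain ⟨e, he, x, hx, rfl⟩ := g.exists_mk
  let inv : M → PseudogroupGerm P := fun y =>
    if hy : y ∈ e.source then mk e he y hy else mk e he x hx
  have hinv : ∀ y (hy : y ∈ e.source), inv y = mk e he y hy := fun y hy => dif_pos hy
  refine ⟨{ toFun := src
            invFun := inv
            source := basicOpen e he Set.univ
            target := e.source
            map_source' := ?_
            map_target' := ?_
            left_inv' := ?_
            right_inv' := ?_
            open_source := isOpen_basicOpen e he isOpen_univ
            open_target := e.open_source
            continuousOn_toFun := continuous_src.continuousOn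
            continuousOn_invFun := ?_ }, mk_mem_basicOpen e he hx trivial, fun _ _ => rfl⟩
  · rintro _ ⟨y, hy, -, rfl⟩
    exact hy
  · intro y hy
    rw [hinv y hy]
    exact mk_mem_basicOpen e he hy trivial
  · rintro _ ⟨y, hy, -, rfl⟩
    exact hinv y hy
  · intro y hy
    rw [hinv y hy]
    rfl
  · rw [continuousOn_iff_continuous_domRestrict]
    convert continuous_mk e he using 1
    exact funext fun y => hinv y y.2

end PseudogroupGerm

theorem TopologicalGroupoid.inv_inv {U : Type*} [TopologicalSpace U] (Γ : TopologicalGroupoid U)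
    (g : Γ.Arr) : Γ.inv (Γ.inv g) = g := by
  have h₁ := Γ.assoc (Γ.inv (Γ.inv g)) (Γ.inv g) g (Γ.src_inv _) (Γ.src_inv _)
  have h₂ := Γ.comp_unit (Γ.inv (Γ.inv g))
  have h₃ := Γ.unit_comp g
  have hs : Γ.src (Γ.inv (Γ.inv g)) = Γ.src g := (Γ.src_inv _).trans (Γ.tgt_inv g)
  simp only [Γ.inv_comp, hs] at h₁ h₂
  rw [h₂] at h₁
  rw [h₁]
  have h₄ : Γ.src (Γ.inv g) = Γ.tgt g := Γ.src_inv g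
  simp only [h₄, h₃]

/-- The inversion of a topological groupoid as a homeomorphism. -/
def TopologicalGroupoid.invHomeomorph {U : Type*} [TopologicalSpace U]
    (Γ : TopologicalGroupoid U) : Γ.Arr ≃ₜ Γ.Arr where
  toFun := Γ.inv
  invFun := Γ.inv
  left_inv := Γ.inv_inv
  right_inv := Γ.inv_inv
  continuous_toFun := Γ.continuous_inv
  continuous_invFun := Γ.continuous_inv

theorem TopologicalGroupoid.isEtale_of_src {U : Type*} [TopologicalSpace U]
    {Γ : TopologicalGroupoid U} (h : IsLocalHomeomorph Γ.src) : Γ.IsEtale where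
  src := h
  tgt := by
    have : Γ.tgt = Γ.src ∘ Γ.invHomeomorph := funext fun g => (Γ.src_inv g).symm
    rw [this]
    exact h.comp Γ.invHomeomorph.isLocalHomeomorph

theorem isEtale_germGroupoid {M : Type u} [TopologicalSpace M] (P : StructureGroupoid M) :
    (germGroupoid P).IsEtale :=
  TopologicalGroupoid.isEtale_of_src PseudogroupGerm.isLocalHomeomorph_src

/-! ### The pseudogroup of an orbifold -/

namespace SatakeOrbifold

variable {n : ℕ} {X : Type u} [TopologicalSpace X] {I : Type v} (O : SatakeOrbifold n X I)

theorem isOpenEmbedding_sigmaMk_inj {j i : I} {h : O.U j ≤ O.U i} {φ} (hφ : φ ∈ O.inj j i h) :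
    Topology.IsOpenEmbedding fun w => (⟨i, φ w⟩ : Σ i, O.dom i) :=
  Topology.IsOpenEmbedding.sigmaMk.comp (O.inj_isOpenEmbedding j i h φ hφ)

/-- `e` is locally of the form `ψ ∘ φ⁻¹`, for injections `φ` and `ψ` with the same source. -/
def IsLocallySpan (e : OpenPartialHomeomorph (Σ i, O.dom i) (Σ i, O.dom i)) : Prop :=
  ∀ x ∈ e.source, ∃ (k i j : I) (hki : O.U k ≤ O.U i) (hkj : O.U k ≤ O.U j),
    ∃ φ ∈ O.inj k i hki, ∃ ψ ∈ O.inj k j hkj, ∃ w, x = ⟨i, φ w⟩ ∧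
      ∀ᶠ w' in 𝓝 w, e ⟨i, φ w'⟩ = ⟨j, ψ w'⟩

variable {O}

theorem IsLocallySpan.symm {e : OpenPartialHomeomorph (Σ i, O.dom i) (Σ i, O.dom i)}
    (he : O.IsLocallySpan e) : O.IsLocallySpan e.symm := by
  intro y hy
  obtain ⟨k, i, j, hki, hkj, φ, hφ, ψ, hψ, w, hw, hev⟩ := he _ (e.map_target hy)
  refine ⟨k, j, i, hkj, hki, ψ, hψ, φ, hφ, w, ?_, ?_⟩
  · rw [← hev.self_of_nhds, ← hw]
    exact (e.right_inv hy).symm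
  · have h₁ : ∀ᶠ w' in 𝓝 w, (⟨i, φ w'⟩ : Σ i, O.dom i) ∈ e.source :=
      (O.isOpenEmbedding_sigmaMk_inj hφ).continuous.continuousAt.eventually
        (e.open_source.mem_nhds (by simpa only [hw] using e.map_target hy))
    filter_upwards [hev, h₁] with w' h₂ h₃
    rw [← h₂]
    exact e.left_inv h₃

theorem IsLocallySpan.trans {e e' : OpenPartialHomeomorph (Σ i, O.dom i) (Σ i, O.dom i)}
    (he : O.IsLocallySpan e) (he' : O.IsLocallySpan e') : O.IsLocallySpan (e ≫ₕ e') := by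
  intro x hx
  rw [OpenPartialHomeomorph.trans_source] at hx
  obtain ⟨k, i, j, hki, hkj, φ, hφ, ψ, hψ, w, rfl, hev⟩ := he x hx.1
  obtain ⟨l, j', i', hlj, hli, φ', hφ', ψ', hψ', w', hw', hev'⟩ := he' _ hx.2
  rw [hev.self_of_nhds, Sigma.mk.inj_iff] at hw'
  obtain ⟨rfl, hw'⟩ := hw'
  -- The injections `ψ` and `φ'` agree at the middle point, so spans compose by passing to a common
  -- factor.
  obtain ⟨m, hmk, hml, θ, hθ, θ', hθ', v, rfl, rfl, hθθ'⟩ :=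
    O.exists_common_factor hψ hφ' (eq_of_heq hw')
  refine ⟨m, i, i', hmk.trans hki, hml.trans hli, _, O.inj_comp m k i hmk hki θ hθ φ hφ, _,
    O.inj_comp m l i' hml hli θ' hθ' ψ' hψ', v, rfl, ?_⟩
  filter_upwards [(O.continuous_inj hθ).continuousAt.eventually hev,
    (O.continuous_inj hθ').continuousAt.eventually hev'] with v' h₁ h₂
  rw [OpenPartialHomeomorph.coe_trans, Function.comp_apply, h₁, hθθ', h₂]

variable (O)

/-- The pseudogroup of the local homeomorphisms that are locally of the form `ψ ∘ φ⁻¹`. -/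
def spanPseudogroup : StructureGroupoid (Σ i, O.dom i) where
  members := {e | O.IsLocallySpan e}
  trans' _ _ h h' := h.trans h'
  symm' _ h := h.symm
  id_mem' := by
    rintro ⟨i, x⟩ -
    exact ⟨i, i, i, le_rfl, le_rfl, id, O.id_mem_inj i, id, O.id_mem_inj i, x, rfl,
      Filter.Eventually.of_forall fun _ => rfl⟩
  locality' := by
    intro e h x hx
    obtain ⟨s, hs, hxs, hes⟩ := h x hx
    have hx' : x ∈ (e.restr s).source := by
      rw [e.restr_source, hs.interior_eq]
      exact ⟨hx, hxs⟩
    exact hes x hx'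
  mem_of_eqOnSource' := by
    intro e e' h hee' x hx
    obtain ⟨k, i, j, hki, hkj, φ, hφ, ψ, hψ, w, rfl, hev⟩ := h x (hee'.1 ▸ hx)
    refine ⟨k, i, j, hki, hkj, φ, hφ, ψ, hψ, w, rfl, ?_⟩
    have h₁ : ∀ᶠ w' in 𝓝 w, (⟨i, φ w'⟩ : Σ i, O.dom i) ∈ e'.source :=
      (O.isOpenEmbedding_sigmaMk_inj hφ).continuous.continuousAt.eventually
        (e'.open_source.mem_nhds hx)
    filter_upwards [hev, h₁] with w' h₂ h₃
    rw [hee'.2 h₃, h₂]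

/-- The spans form a pseudogroup that is closed under restriction and contains the injections, while
the generated pseudogroup is the infimum of all such. -/
theorem isLocallySpan_of_mem {e : OpenPartialHomeomorph (Σ i, O.dom i) (Σ i, O.dom i)}
    (he : e ∈ generatedPseudogroup O.injections) : O.IsLocallySpan e := by
  have hle : generatedPseudogroup O.injections ≤ O.spanPseudogroup := by
    refine sInf_le ⟨⟨fun {e} he s hs x hx => ?_⟩, ?_⟩
    · rw [OpenPartialHomeomorph.restr_source] at hx
      exact he x hx.1
    · rintro e ⟨k, j, hkj, φ, hφ, hs, he⟩ x hx
      rw [hs] at hx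
      obtain ⟨w, rfl⟩ := hx
      exact ⟨k, k, j, le_rfl, hkj, id, O.id_mem_inj k, φ, hφ, w, rfl,
        Filter.Eventually.of_forall fun w => he w⟩
  exact hle he

/-- An injection as an open partial homeomorphism of the disjoint union of the charts. -/
noncomputable def injHomeo {k i : I} {hki : O.U k ≤ O.U i} {φ : O.dom k → O.dom i}
    (hφ : φ ∈ O.inj k i hki) : OpenPartialHomeomorph (Σ i, O.dom i) (Σ i, O.dom i) :=
  haveI := O.nonempty_dom k
  (Topology.IsOpenEmbedding.toOpenPartialHomeomorph _
    (Topology.IsOpenEmbedding.sigmaMk (σ := fun i => O.dom i) (i := k))).symm ≫ₕ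
    (Topology.IsOpenEmbedding.toOpenPartialHomeomorph _ (O.isOpenEmbedding_sigmaMk_inj hφ))

section

variable {k i j : I} {hki : O.U k ≤ O.U i} {hkj : O.U k ≤ O.U j} {φ : O.dom k → O.dom i}
  {ψ : O.dom k → O.dom j} (hφ : φ ∈ O.inj k i hki) (hψ : ψ ∈ O.inj k j hkj)

theorem injHomeo_source : (O.injHomeo hφ).source = Set.range (Sigma.mk k) := by
  simp [injHomeo]

theorem injHomeo_apply (w : O.dom k) : O.injHomeo hφ ⟨k, w⟩ = ⟨i, φ w⟩ := by
  have := O.nonempty_dom k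
  have h : (Topology.IsOpenEmbedding.toOpenPartialHomeomorph _
      (Topology.IsOpenEmbedding.sigmaMk (σ := fun i => O.dom i) (i := k))).symm ⟨k, w⟩ = w :=
    Topology.IsOpenEmbedding.toOpenPartialHomeomorph_left_inv _ _
  simp [injHomeo, h]

theorem injHomeo_mem : O.injHomeo hφ ∈ generatedPseudogroup O.injections := by
  refine Set.mem_iInter₂.mpr fun P hP => ?_
  exact hP.2 _ ⟨k, i, hki, φ, hφ, O.injHomeo_source hφ, O.injHomeo_apply hφ⟩

/-- The local homeomorphism `ψ ∘ φ⁻¹`. -/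
noncomputable def spanHomeo : OpenPartialHomeomorph (Σ i, O.dom i) (Σ i, O.dom i) :=
  (O.injHomeo hφ).symm ≫ₕ O.injHomeo hψ

theorem spanHomeo_mem : O.spanHomeo hφ hψ ∈ generatedPseudogroup O.injections :=
  StructureGroupoid.trans _ (StructureGroupoid.symm _ (O.injHomeo_mem hφ)) (O.injHomeo_mem hψ)

theorem injHomeo_symm_apply (w : O.dom k) : (O.injHomeo hφ).symm ⟨i, φ w⟩ = ⟨k, w⟩ := by
  rw [← O.injHomeo_apply hφ]
  refine (O.injHomeo hφ).left_inv ?_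
  rw [O.injHomeo_source]
  exact ⟨w, rfl⟩

theorem mem_spanHomeo_source (w : O.dom k) : ⟨i, φ w⟩ ∈ (O.spanHomeo hφ hψ).source := by
  rw [spanHomeo, OpenPartialHomeomorph.trans_source]
  refine ⟨?_, ?_⟩
  · rw [← O.injHomeo_apply hφ]
    refine (O.injHomeo hφ).map_source ?_
    rw [O.injHomeo_source]
    exact ⟨w, rfl⟩
  · rw [Set.mem_preimage, O.injHomeo_symm_apply, O.injHomeo_source]
    exact ⟨w, rfl⟩

theorem spanHomeo_apply (w : O.dom k) : O.spanHomeo hφ hψ ⟨i, φ w⟩ = ⟨j, ψ w⟩ := by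
  rw [spanHomeo, OpenPartialHomeomorph.coe_trans, Function.comp_apply, O.injHomeo_symm_apply,
    O.injHomeo_apply]

/-- The arrows of the groupoid of an orbifold: germs of local homeomorphisms. -/
abbrev Germ : Type _ := PseudogroupGerm (generatedPseudogroup O.injections)

/-- The germ of `ψ ∘ φ⁻¹` at `φ w`. -/
noncomputable def spanGerm (w : O.dom k) : O.Germ :=
  PseudogroupGerm.mk (O.spanHomeo hφ hψ) (O.spanHomeo_mem hφ hψ) ⟨i, φ w⟩
    (O.mem_spanHomeo_source hφ hψ w)

theorem src_spanGerm (w : O.dom k) : (O.spanGerm hφ hψ w).src = ⟨i, φ w⟩ := rfl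

theorem tgt_spanGerm (w : O.dom k) : (O.spanGerm hφ hψ w).tgt = ⟨j, ψ w⟩ :=
  O.spanHomeo_apply hφ hψ w

theorem continuous_spanGerm : Continuous (O.spanGerm hφ hψ) :=
  (PseudogroupGerm.continuous_mk _ (O.spanHomeo_mem hφ hψ)).comp
    ((O.isOpenEmbedding_sigmaMk_inj hφ).continuous.subtype_mk (O.mem_spanHomeo_source hφ hψ))

theorem mk_eq_spanGerm {e : OpenPartialHomeomorph (Σ i, O.dom i) (Σ i, O.dom i)}
    (he : e ∈ generatedPseudogroup O.injections) {x : Σ i, O.dom i} (hx : x ∈ e.source)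
    {w : O.dom k} (hw : x = ⟨i, φ w⟩) (hev : ∀ᶠ w' in 𝓝 w, e ⟨i, φ w'⟩ = ⟨j, ψ w'⟩) :
    PseudogroupGerm.mk e he x hx = O.spanGerm hφ hψ w := by
  refine PseudogroupGerm.mk_eq_mk.mpr ⟨hw, ?_⟩
  rw [hw, Filter.EventuallyEq, ← (O.isOpenEmbedding_sigmaMk_inj hφ).map_nhds_eq,
    Filter.eventually_map]
  filter_upwards [hev] with w' hw'
  rw [hw', O.spanHomeo_apply]

/-- Reparametrizing both legs of a span by the same `θ` leaves the germ unchanged. Here `θ` may be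
an injection or an element of the chart group. -/
theorem spanGerm_comp {m : I} {hmi : O.U m ≤ O.U i} {hmj : O.U m ≤ O.U j} {φ' : O.dom m → O.dom i}
    {ψ' : O.dom m → O.dom j} (hφ' : φ' ∈ O.inj m i hmi) (hψ' : ψ' ∈ O.inj m j hmj)
    {θ : O.dom m → O.dom k} (h₁ : ∀ v, φ (θ v) = φ' v) (h₂ : ∀ v, ψ (θ v) = ψ' v) (v : O.dom m) :
    O.spanGerm hφ hψ (θ v) = O.spanGerm hφ' hψ' v := by
  refine O.mk_eq_spanGerm hφ' hψ' _ _ (by rw [h₁]) (Filter.Eventually.of_forall fun v' => ?_)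
  rw [← h₁, O.spanHomeo_apply, h₂]

/-- Rigidity for germs: two injections with the same source chart and target chart differ by a group
element, which is trivial once they agree near one point. -/
theorem eq_of_spanGerm_eq {ψ' : O.dom k → O.dom j} (hψ' : ψ' ∈ O.inj k j hkj) {w : O.dom k}
    (h : O.spanGerm hφ hψ w = O.spanGerm hφ hψ' w) : ψ = ψ' := by
  obtain ⟨-, hev⟩ := PseudogroupGerm.mk_eq_mk.mp h
  rw [Filter.EventuallyEq, ← (O.isOpenEmbedding_sigmaMk_inj hφ).map_nhds_eq,
    Filter.eventually_map] at hev
  obtain ⟨g, hg, hgψ⟩ := O.inj_transitive k j hkj ψ hψ ψ' hψ'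
  have hg1 : g = 1 := by
    refine O.eq_one_of_eventually hg (x := ψ w) ?_
    rw [← (O.inj_isOpenEmbedding k j hkj ψ hψ).map_nhds_eq, Filter.eventually_map]
    filter_upwards [hev] with w' hw'
    rw [O.spanHomeo_apply, O.spanHomeo_apply, Sigma.mk.inj_iff] at hw'
    rw [← hgψ, eq_of_heq hw'.2]
  funext w'
  rw [hgψ, hg1]
  rfl

end

/-! ### Normal forms of arrows and separation of germs. -/

theorem exists_spanGerm (γ : O.Germ) :
    ∃ (k i j : I) (hki : O.U k ≤ O.U i) (hkj : O.U k ≤ O.U j) (φ : O.dom k → O.dom i)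
      (hφ : φ ∈ O.inj k i hki) (ψ : O.dom k → O.dom j) (hψ : ψ ∈ O.inj k j hkj) (w : O.dom k),
      γ = O.spanGerm hφ hψ w := by
  obtain ⟨e, he, x, hx, rfl⟩ := γ.exists_mk
  obtain ⟨k, i, j, hki, hkj, φ, hφ, ψ, hψ, w, hw, hev⟩ := O.isLocallySpan_of_mem he x hx
  exact ⟨k, i, j, hki, hkj, φ, hφ, ψ, hψ, w, O.mk_eq_spanGerm hφ hψ he hx hw hev⟩

theorem exists_spanGerm_of_src_tgt {i j : I} {x : O.dom i} {y : O.dom j} {γ : O.Germ}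
    (hs : γ.src = ⟨i, x⟩) (ht : γ.tgt = ⟨j, y⟩) :
    ∃ (k : I) (hki : O.U k ≤ O.U i) (hkj : O.U k ≤ O.U j) (φ : O.dom k → O.dom i)
      (hφ : φ ∈ O.inj k i hki) (ψ : O.dom k → O.dom j) (hψ : ψ ∈ O.inj k j hkj) (w : O.dom k),
      γ = O.spanGerm hφ hψ w ∧ φ w = x ∧ ψ w = y := by
  obtain ⟨k, i', j', hki, hkj, φ, hφ, ψ, hψ, w, rfl⟩ := O.exists_spanGerm γ
  rw [O.src_spanGerm, Sigma.mk.inj_iff] at hs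
  rw [O.tgt_spanGerm, Sigma.mk.inj_iff] at ht
  obtain ⟨rfl, hs⟩ := hs
  obtain ⟨rfl, ht⟩ := ht
  exact ⟨k, hki, hkj, φ, hφ, ψ, hψ, w, rfl, eq_of_heq hs, eq_of_heq ht⟩

theorem π_eq_of_germ {i j : I} {x : O.dom i} {y : O.dom j} {γ : O.Germ}
    (hs : γ.src = ⟨i, x⟩) (ht : γ.tgt = ⟨j, y⟩) : O.π i x = O.π j y := by
  obtain ⟨k, hki, hkj, φ, hφ, ψ, hψ, w, -, rfl, rfl⟩ := O.exists_spanGerm_of_src_tgt hs ht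
  rw [O.π_inj k i hki φ hφ, O.π_inj k j hkj ψ hψ]

theorem exists_germ {i j : I} {x : O.dom i} {y : O.dom j} (h : O.π i x = O.π j y) :
    ∃ γ : O.Germ, γ.src = ⟨i, x⟩ ∧ γ.tgt = ⟨j, y⟩ := by
  obtain ⟨k, hk, hkle⟩ := O.directed i j (O.π i x) ⟨O.π_mem x, h ▸ O.π_mem y⟩
  obtain ⟨w, hw⟩ := O.exists_π_eq hk
  obtain ⟨φ, hφ, rfl⟩ := O.exists_inj_apply_eq (hkle.trans inf_le_left) hw
  obtain ⟨ψ, hψ, rfl⟩ := O.exists_inj_apply_eq (hkle.trans inf_le_right) (hw.trans h)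
  exact ⟨O.spanGerm hφ hψ w, rfl, O.tgt_spanGerm hφ hψ w⟩

/-- Germs with the same source and targets in the same chart are represented over a common
injection. -/
theorem exists_spanGerm_pair {i j : I} {x : O.dom i} {y y' : O.dom j} {γ γ' : O.Germ}
    (hs : γ.src = ⟨i, x⟩) (ht : γ.tgt = ⟨j, y⟩) (hs' : γ'.src = ⟨i, x⟩) (ht' : γ'.tgt = ⟨j, y'⟩) :
    ∃ (k : I) (hki : O.U k ≤ O.U i) (hkj : O.U k ≤ O.U j) (φ : O.dom k → O.dom i)
      (hφ : φ ∈ O.inj k i hki) (ψ : O.dom k → O.dom j) (hψ : ψ ∈ O.inj k j hkj)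
      (ψ' : O.dom k → O.dom j) (hψ' : ψ' ∈ O.inj k j hkj) (w : O.dom k),
      γ = O.spanGerm hφ hψ w ∧ γ' = O.spanGerm hφ hψ' w := by
  obtain ⟨k, hki, hkj, φ, hφ, ψ, hψ, w, rfl, hw, -⟩ := O.exists_spanGerm_of_src_tgt hs ht
  obtain ⟨l, hli, hlj, φ', hφ', ψ', hψ', w', rfl, hw', -⟩ := O.exists_spanGerm_of_src_tgt hs' ht'
  obtain ⟨m, hmk, hml, θ, hθ, θ', hθ', v, rfl, rfl, hθθ'⟩ :=
    O.exists_common_factor hφ hφ' (hw.trans hw'.symm)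
  refine ⟨m, hmk.trans hki, hmk.trans hkj, _, O.inj_comp m k i hmk hki θ hθ φ hφ, _,
    O.inj_comp m k j hmk hkj θ hθ ψ hψ, _, O.inj_comp m l j hml hlj θ' hθ' ψ' hψ', v, ?_, ?_⟩
  · exact O.spanGerm_comp hφ hψ _ _ (fun _ => rfl) (fun _ => rfl) v
  · exact O.spanGerm_comp hφ' hψ' _ _ (fun v => (hθθ' v).symm) (fun _ => rfl) v

/-- A germ can be represented over any injection, from a chart contained in both charts, through
its source. -/
theorem exists_eq_spanGerm {i j l : I} (hli : O.U l ≤ O.U i) (hlj : O.U l ≤ O.U j)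
    {φ : O.dom l → O.dom i} (hφ : φ ∈ O.inj l i hli) {w : O.dom l} {y : O.dom j} {γ : O.Germ}
    (hs : γ.src = ⟨i, φ w⟩) (ht : γ.tgt = ⟨j, y⟩) :
    ∃ (ψ : O.dom l → O.dom j) (hψ : ψ ∈ O.inj l j hlj), γ = O.spanGerm hφ hψ w ∧ ψ w = y := by
  obtain ⟨k, hki, hkj, φ', hφ', ψ', hψ', w', rfl, hw', rfl⟩ := O.exists_spanGerm_of_src_tgt hs ht
  obtain ⟨m, hmk, hml, θ, hθ, θ', hθ', v, rfl, rfl, hθθ'⟩ := O.exists_common_factor hφ' hφ hw'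
  obtain ⟨ψ₀, hψ₀⟩ := O.inj_nonempty l j hlj
  -- Any injection `ψ₀` from `U l` agrees over the smaller chart `m` with the given germ up to some
  -- `g`; then `g ∘ ψ₀` is the required injection, defined on all of the chart `l`.
  obtain ⟨g, hg, hgψ⟩ := O.inj_transitive m j (hmk.trans hkj) _
    (O.inj_comp m l j hml hlj θ' hθ' ψ₀ hψ₀) _ (O.inj_comp m k j hmk hkj θ hθ ψ' hψ')
  refine ⟨_, O.inj_smul l j hlj ψ₀ hψ₀ g hg, ?_, (hgψ v).symm⟩
  rw [O.spanGerm_comp hφ' hψ' (O.inj_comp m k i hmk hki θ hθ φ' hφ')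
    (O.inj_comp m k j hmk hkj θ hθ ψ' hψ') (fun _ => rfl) (fun _ => rfl) v]
  exact (O.spanGerm_comp hφ _ _ _ (fun v => (hθθ' v).symm) (fun v => (hgψ v).symm) v).symm

/-- Germs with different ends are separated in the unit space. Otherwise both are spans over one
injection `φ`, with second legs `ψ` and `ψ'`; their germs along the whole chart fill two open sets,
and a common point would force `ψ = ψ'`. Separation is what gives uniqueness of lifts in (C2). -/
instance t2Space_germ : T2Space O.Germ := by
  refine ⟨fun γ γ' hne => ?_⟩
  by_cases hs : γ.src = γ'.src
  swap
  · obtain ⟨u, v, hu, hv, h₁, h₂, h₃⟩ := t2_separation hs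
    exact ⟨_, _, hu.preimage PseudogroupGerm.continuous_src,
      hv.preimage PseudogroupGerm.continuous_src, h₁, h₂, h₃.preimage _⟩
  by_cases ht : γ.tgt = γ'.tgt
  swap
  · obtain ⟨u, v, hu, hv, h₁, h₂, h₃⟩ := t2_separation ht
    exact ⟨_, _, hu.preimage PseudogroupGerm.continuous_tgt,
      hv.preimage PseudogroupGerm.continuous_tgt, h₁, h₂, h₃.preimage _⟩
  obtain ⟨i, x, hx⟩ : ∃ i x, γ.src = ⟨i, x⟩ := ⟨_, _, rfl⟩
  obtain ⟨j, y, hy⟩ : ∃ j y, γ.tgt = ⟨j, y⟩ := ⟨_, _, rfl⟩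
  obtain ⟨k, hki, hkj, φ, hφ, ψ, hψ, ψ', hψ', w, rfl, rfl⟩ :=
    O.exists_spanGerm_pair hx hy (hs ▸ hx) (ht ▸ hy)
  have hop : ∀ {ψ} (hψ : ψ ∈ O.inj k j hkj), IsOpen (Set.range (O.spanGerm hφ hψ)) := fun hψ =>
    (PseudogroupGerm.isLocalHomeomorph_src.isOpenEmbedding_of_comp (f := O.spanGerm hφ hψ)
      (O.isOpenEmbedding_sigmaMk_inj hφ) (O.continuous_spanGerm hφ hψ)).isOpen_range
  refine ⟨_, _, hop hψ, hop hψ', ⟨w, rfl⟩, ⟨w, rfl⟩, ?_⟩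
  rw [Set.disjoint_left]
  rintro _ ⟨v, rfl⟩ ⟨v', hv⟩
  have h₁ : v' = v := (O.isOpenEmbedding_sigmaMk_inj hφ).injective
    (congrArg PseudogroupGerm.src hv)
  subst h₁
  exact hne (by congr 1; exact O.eq_of_spanGerm_eq hφ hψ hψ' hv.symm)

end SatakeOrbifold

/-! ### Local homeomorphisms -/

theorem isLocalHomeomorph_of_isOpenMap {X Y : Type*} [TopologicalSpace X] [TopologicalSpace Y]
    {f : X → Y} (hc : Continuous f) (ho : IsOpenMap f) (hi : IsLocallyInjective f) :
    IsLocalHomeomorph f := by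
  refine isLocalHomeomorph_iff_isOpenEmbedding_restrict.mpr fun x => ?_
  obtain ⟨U, hU, hxU, hUf⟩ := hi x
  exact ⟨U, hU.mem_nhds hxU, .of_continuous_injective_isOpenMap
    (hc.comp continuous_subtype_val) (fun y z hyz => Subtype.ext (hUf y.2 z.2 hyz))
    (ho.comp hU.isOpenMap_subtype_val)⟩

theorem isLocalHomeomorph_sigma {A Z : Type*} {Y : A → Type*} [∀ a, TopologicalSpace (Y a)]
    [TopologicalSpace Z] {f : (Σ a, Y a) → Z}
    (h : ∀ a, Topology.IsOpenEmbedding fun y => f ⟨a, y⟩) : IsLocalHomeomorph f := by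
  refine isLocalHomeomorph_of_isOpenMap (continuous_sigma fun a => (h a).continuous)
    (isOpenMap_sigma.mpr fun a => (h a).isOpenMap) ?_
  rintro ⟨a, y⟩
  refine ⟨Set.range (Sigma.mk a), isOpen_range_sigmaMk, ⟨y, rfl⟩, ?_⟩
  rintro _ ⟨y₁, rfl⟩ _ ⟨y₂, rfl⟩ h₁₂
  exact congrArg _ ((h a).injective h₁₂)

theorem IsLocalHomeomorph.locallyConnectedSpace {X Y : Type*} [TopologicalSpace X]
    [TopologicalSpace Y] [LocallyConnectedSpace Y] {f : X → Y} (hf : IsLocalHomeomorph f) :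
    LocallyConnectedSpace X := by
  refine locallyConnectedSpace_iff_connected_subsets.mpr fun x W hW => ?_
  obtain ⟨U, hU, hUf⟩ := isLocalHomeomorph_iff_isOpenEmbedding_restrict.mp hf x
  have hUl : LocallyConnectedSpace U := hUf.locallyConnectedSpace
  obtain ⟨T, hT, hTc, hTW⟩ := locallyConnectedSpace_iff_connected_subsets.mp hUl
    (⟨x, mem_of_mem_nhds hU⟩ : U) _ (continuous_subtype_val.continuousAt.preimage_mem_nhds hW)
  refine ⟨Subtype.val '' T, ?_, hTc.image _ continuous_subtype_val.continuousOn,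
    Set.image_subset_iff.mpr hTW⟩
  rw [← map_nhds_subtype_coe_eq_nhds (mem_of_mem_nhds hU) hU]
  exact Filter.image_mem_map hT

/-- A component `C` of `N` is mapped homeomorphically onto a component of `p '' N` when `p` has a
section over the latter with values in `N` and through a point of `C`. -/
theorem isEmbedding_and_image_connectedComponentIn {E B : Type*} [TopologicalSpace E]
    [TopologicalSpace B] [T2Space E] {p : E → B} (hpc : Continuous p) (hpi : IsLocallyInjective p)
    {N : Set E} {t : E} (ht : t ∈ N) {ρ : connectedComponentIn (p '' N) (p t) → E}
    (hρ : Continuous ρ) (hpρ : ∀ z, p (ρ z) = z) (hρN : ∀ z, ρ z ∈ N)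
    (hρt : ∀ h, ρ ⟨p t, h⟩ = t) :
    Topology.IsEmbedding ((connectedComponentIn N t).domRestrict p) ∧
      p '' connectedComponentIn N t = connectedComponentIn (p '' N) (p t) := by
  have hpt : p t ∈ p '' N := Set.mem_image_of_mem p ht
  have hCW : p '' connectedComponentIn N t ⊆ connectedComponentIn (p '' N) (p t) :=
    (isPreconnected_connectedComponentIn.image p hpc.continuousOn).subset_connectedComponentIn
      (Set.mem_image_of_mem p (mem_connectedComponentIn ht))
      (Set.image_mono (connectedComponentIn_subset N t))
  -- The image of the section is connected and contains `t`.
  have hρC : Set.range ρ ⊆ connectedComponentIn N t := by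
    have : PreconnectedSpace (connectedComponentIn (p '' N) (p t)) :=
      Subtype.preconnectedSpace isPreconnected_connectedComponentIn
    exact (isPreconnected_range hρ).subset_connectedComponentIn
      ⟨⟨p t, mem_connectedComponentIn hpt⟩, hρt _⟩ (Set.range_subset_iff.mpr hρN)
  have : PreconnectedSpace (connectedComponentIn N t) :=
    Subtype.preconnectedSpace isPreconnected_connectedComponentIn
  let q : connectedComponentIn N t → connectedComponentIn (p '' N) (p t) := fun c =>
    ⟨p c, hCW (Set.mem_image_of_mem p c.2)⟩
  have hq : Continuous q := (hpc.comp continuous_subtype_val).subtype_mk _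
  -- Uniqueness of lifts: both maps lift `q` through `p` and agree at `t`, and the component is
  -- connected.
  have hρq : ρ ∘ q = Subtype.val :=
    (T2Space.isSeparatedMap p).eq_of_comp_eq hpi (hρ.comp hq) continuous_subtype_val
      (funext fun c => hpρ (q c)) ⟨t, mem_connectedComponentIn ht⟩ (hρt _)
  refine ⟨?_, hCW.antisymm fun z hz => ⟨ρ ⟨z, hz⟩, hρC ⟨_, rfl⟩, hpρ _⟩⟩
  have h₁ : Function.LeftInverse
      (fun z => (⟨ρ z, hρC ⟨z, rfl⟩⟩ : connectedComponentIn N t)) q := fun c =>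
    Subtype.ext (congrFun hρq c)
  exact Topology.IsEmbedding.subtypeVal.comp (h₁.isEmbedding (hρ.subtype_mk _) hq)

/-! ### Restrictions of étale groupoids -/

namespace TopologicalGroupoid

section

variable {U V : Type*} [TopologicalSpace U] [TopologicalSpace V] {Γ : TopologicalGroupoid U}
  {F : V → U}

theorem isLocalHomeomorph_restrictHom (hF : IsLocalHomeomorph F) :
    IsLocalHomeomorph (Γ.restrictHom F hF.continuous).map := by
  refine isLocalHomeomorph_of_isOpenMap (Γ.restrictHom F hF.continuous).continuous_map ?_ ?_
  · intro s hs
    refine isOpen_iff_mem_nhds.mpr ?_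
    rintro _ ⟨⟨⟨x, y, γ⟩, hx, hy⟩, ht, rfl⟩
    obtain ⟨s', hs', rfl⟩ := hs
    have h₁ := hs'.mem_nhds ht
    rw [mem_nhds_prod_iff'] at h₁
    obtain ⟨A, T, hA, hxA, hT, hyT, hAT⟩ := h₁
    have h₂ := hT.mem_nhds hyT
    rw [mem_nhds_prod_iff'] at h₂
    obtain ⟨B, O, hB, hyB, hO, hγO, hBO⟩ := h₂
    -- Arrows near `γ` have their ends in the open sets `F '' A` and `F '' B`, so these ends lift to
    -- `A` and `B`.
    have h₃ : O ∩ (Γ.src ⁻¹' (F '' A) ∩ Γ.tgt ⁻¹' (F '' B)) ∈ 𝓝 γ :=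
      Filter.inter_mem (hO.mem_nhds hγO) (Filter.inter_mem
        (((hF.isOpenMap A hA).preimage Γ.continuous_src).mem_nhds ⟨x, hxA, hx.symm⟩)
        (((hF.isOpenMap B hB).preimage Γ.continuous_tgt).mem_nhds ⟨y, hyB, hy.symm⟩))
    refine Filter.mem_of_superset h₃ ?_
    rintro γ' ⟨h₄, ⟨x', hx', hxx'⟩, ⟨y', hy', hyy'⟩⟩
    exact ⟨⟨(x', y', γ'), hxx'.symm, hyy'.symm⟩, hAT ⟨hx', hBO ⟨hy', h₄⟩⟩, rfl⟩
  · rintro ⟨⟨x, y, γ⟩, hx, hy⟩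
    obtain ⟨A, hA, hxA, hAF⟩ := hF.isLocallyInjective x
    obtain ⟨B, hB, hyB, hBF⟩ := hF.isLocallyInjective y
    refine ⟨Subtype.val ⁻¹' (A ×ˢ B ×ˢ Set.univ), (hA.prod (hB.prod isOpen_univ)).preimage
      continuous_subtype_val, ⟨hxA, hyB, trivial⟩, ?_⟩
    rintro ⟨⟨x₁, y₁, γ₁⟩, hx₁, hy₁⟩ ⟨hxA₁, hyB₁, -⟩ ⟨⟨x₂, y₂, γ₂⟩, hx₂, hy₂⟩ ⟨hxA₂, hyB₂, -⟩ h
    obtain rfl : γ₁ = γ₂ := h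
    obtain rfl : x₁ = x₂ := hAF hxA₁ hxA₂ (hx₁.symm.trans hx₂)
    obtain rfl : y₁ = y₂ := hBF hyB₁ hyB₂ (hy₁.symm.trans hy₂)
    rfl

theorem IsEtale.restrict (hΓ : Γ.IsEtale) (hF : IsLocalHomeomorph F) :
    (Γ.restrict F hF.continuous).IsEtale := by
  refine isEtale_of_src (IsLocalHomeomorph.of_comp (g := F) ?_ hF
    (Γ.restrict F hF.continuous).continuous_src)
  have : F ∘ (Γ.restrict F hF.continuous).src = Γ.src ∘ (Γ.restrictHom F hF.continuous).map :=
    funext fun t => t.2.1.symm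
  rw [this]
  exact hΓ.src.comp (isLocalHomeomorph_restrictHom hF)

theorem isEquivalence_restrictHom (hΓ : Γ.IsEtale) (hF : IsLocalHomeomorph F)
    (h : ∀ u, ∃ x, Γ.orbitSetoid (F x) u) :
    (Γ.restrictHom F hF.continuous).IsEquivalence where
  etale_source := hΓ.restrict hF
  etale_target := hΓ
  localHomeo := isLocalHomeomorph_restrictHom hF
  orbits := by
    constructor
    · rintro ⟨x⟩ ⟨y⟩ hxy
      obtain ⟨γ, hs, ht⟩ := Quotient.exact hxy
      exact Quotient.sound ⟨⟨(x, y, γ), hs, ht⟩, rfl, rfl⟩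
    · rintro ⟨u⟩
      obtain ⟨x, hx⟩ := h u
      exact ⟨Quotient.mk _ x, Quotient.sound hx⟩
  isotropy := by
    intro x
    refine ⟨?_, ?_, ?_⟩
    · rintro ⟨⟨x₁, y₁, γ⟩, hx, hy⟩ ⟨h₁, h₂⟩
      obtain rfl : x₁ = x := h₁
      obtain rfl : y₁ = x₁ := h₂
      exact ⟨hx, hy⟩
    · rintro ⟨⟨x₁, y₁, γ₁⟩, hx₁, hy₁⟩ ⟨h₁, h₂⟩ ⟨⟨x₂, y₂, γ₂⟩, hx₂, hy₂⟩ ⟨h₃, h₄⟩ h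
      obtain rfl : γ₁ = γ₂ := h
      obtain rfl : x₁ = x := h₁
      obtain rfl : y₁ = x₁ := h₂
      obtain rfl : x₂ = y₁ := h₃
      obtain rfl : y₂ = x₂ := h₄
      rfl
    · rintro γ ⟨hs, ht⟩
      exact ⟨⟨(x, x, γ), hs, ht⟩, ⟨rfl, rfl⟩, rfl⟩

end

/-- By inversion, it suffices to check (C2) for the source map. -/
theorem C2_of_src {A : Type*} {Y : A → Type*} [∀ a, TopologicalSpace (Y a)]
    {Γ : TopologicalGroupoid (Σ a, Y a)}
    (h : ∀ a b, ∀ g ∈ Γ.chartArrows a b,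
      Topology.IsEmbedding ((connectedComponentIn (Γ.chartArrows a b) g).domRestrict Γ.src) ∧
        Γ.src '' connectedComponentIn (Γ.chartArrows a b) g =
          connectedComponentIn (Γ.src '' Γ.chartArrows a b) (Γ.src g)) : Γ.C2 := by
  intro a b g hg
  refine ⟨h a b g hg, ?_⟩
  have hsrc : ∀ k, Γ.src (Γ.invHomeomorph k) = Γ.tgt k := Γ.src_inv
  have htgt : ∀ k, Γ.tgt (Γ.invHomeomorph k) = Γ.src k := Γ.tgt_inv
  have hN : Γ.invHomeomorph '' Γ.chartArrows a b = Γ.chartArrows b a := by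
    ext k
    constructor
    · rintro ⟨k, ⟨h₁, h₂⟩, rfl⟩
      exact ⟨(congrArg Sigma.fst (hsrc k)).trans h₂, (congrArg Sigma.fst (htgt k)).trans h₁⟩
    · rintro ⟨h₁, h₂⟩
      exact ⟨Γ.inv k, ⟨(congrArg Sigma.fst (Γ.src_inv k)).trans h₂,
        (congrArg Sigma.fst (Γ.tgt_inv k)).trans h₁⟩, Γ.inv_inv k⟩
  have himg : ∀ s : Set Γ.Arr, Γ.src '' (Γ.invHomeomorph '' s) = Γ.tgt '' s := fun s => by
    rw [Set.image_image]
    exact Set.image_congr fun k _ => hsrc k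
  have key := h b a (Γ.invHomeomorph g) (hN ▸ Set.mem_image_of_mem _ hg)
  rw [← hN, ← Γ.invHomeomorph.image_connectedComponentIn hg, himg, himg, hsrc] at key
  refine ⟨?_, key.2⟩
  have h₁ := key.1.comp
    (Γ.invHomeomorph.image (connectedComponentIn (Γ.chartArrows a b) g)).isEmbedding
  convert h₁ using 1
  exact funext fun k => (hsrc k).symm

end TopologicalGroupoid

/-! ### Covers of paracompact spaces -/

theorem exists_locallyFinite_closed_shrinking {X ι : Type*} [TopologicalSpace X] [T2Space X]
    [ParacompactSpace X] {u : ι → Set X} (hu : ∀ i, IsOpen (u i)) (hc : ⋃ i, u i = Set.univ) :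
    ∃ v F : ι → Set X, (∀ i, IsOpen (v i)) ∧ LocallyFinite v ∧ (∀ i, v i ⊆ u i) ∧
      (∀ i, IsClosed (F i)) ∧ (∀ i, F i ⊆ v i) ∧ ⋃ i, F i = Set.univ := by
  obtain ⟨v, hv, hvc, hvf, hvu⟩ := precise_refinement u hu hc
  obtain ⟨F, hFc, hF, hFv⟩ := exists_iUnion_eq_closed_subset hv (fun x => hvf.point_finite x) hvc
  exact ⟨v, F, hv, hvf, hvu, hF, hFv, hFc⟩

/-- By local finiteness the union of the members that miss `x` is closed; its complement is the
neighbourhood. -/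
theorem LocallyFinite.exists_isOpen_forall_inter_nonempty {X ι : Type*} [TopologicalSpace X]
    {F : ι → Set X} (hF : LocallyFinite F) (hFc : ∀ i, IsClosed (F i)) (x : X) :
    ∃ N, IsOpen N ∧ x ∈ N ∧ ∀ i, (N ∩ F i).Nonempty → x ∈ F i := by
  refine ⟨(⋃ i : {i // x ∉ F i}, F i)ᶜ,
    ((hF.comp_injective Subtype.val_injective).isClosed_iUnion fun i => hFc i.1).isOpen_compl,
    by simp, ?_⟩
  rintro i ⟨y, hy, hyi⟩
  by_contra hx
  exact hy (Set.mem_iUnion.mpr ⟨⟨i, hx⟩, hyi⟩)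

/-- An open cover of a paracompact Hausdorff space is refined by neighbourhoods of the points such
that the union of any two of them that meet is contained in a member of the cover. -/
theorem exists_nhds_union_subset {X ι : Type*} [TopologicalSpace X] [T2Space X]
    [ParacompactSpace X] {u : ι → Set X} (hu : ∀ i, IsOpen (u i)) (hc : ⋃ i, u i = Set.univ) :
    ∃ V : X → Set X, (∀ x, IsOpen (V x) ∧ x ∈ V x) ∧
      ∀ x y, (V x ∩ V y).Nonempty → ∃ i, V x ⊆ u i ∧ V y ⊆ u i := by
  obtain ⟨v, F, hv, hvf, hvu, hF, hFv, hFc⟩ := exists_locallyFinite_closed_shrinking hu hc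
  have hFf : LocallyFinite F := hvf.subset hFv
  choose N hN hxN hNF using hFf.exists_isOpen_forall_inter_nonempty hF
  -- If `z` lies in the sets of both `x` and `y` and `z ∈ F i`, then `N x` and `N y` meet `F i`.
  -- Hence `x` and `y` lie in `F i`, and `v i` is among the sets intersected for each of them.
  refine ⟨fun x => N x ∩ ⋂ i ∈ {i | x ∈ F i}, v i, fun x => ⟨?_, hxN x, ?_⟩, ?_⟩
  · exact (hN x).inter ((hFf.point_finite x).isOpen_biInter fun i _ => hv i)
  · exact Set.mem_iInter₂.mpr fun i hi => hFv i hi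
  · rintro x y ⟨z, hzx, hzy⟩
    obtain ⟨i, hi⟩ := Set.mem_iUnion.mp (hFc ▸ Set.mem_univ z)
    have h : ∀ {x}, z ∈ N x → N x ∩ ⋂ i ∈ {i | x ∈ F i}, v i ⊆ u i := fun {x} hz =>
      Set.inter_subset_right.trans
        ((Set.biInter_subset_of_mem (s := {i | x ∈ F i}) (hNF x i ⟨z, hz, hi⟩)).trans (hvu i))
    exact ⟨i, h hzx.1, h hzy.1⟩

/-! ### Good covers of an orbifold. -/

namespace SatakeOrbifold

variable {n : ℕ} {X : Type u} [TopologicalSpace X] {I : Type v} (O : SatakeOrbifold n X I)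

theorem exists_le_of_finite {s : Set I} (hs : s.Finite) {p : X} (hp : ∀ i ∈ s, p ∈ O.U i) :
    ∃ k, p ∈ O.U k ∧ ∀ i ∈ s, O.U k ≤ O.U i := by
  induction s, hs using Set.Finite.induction_on with
  | empty =>
    obtain ⟨k, hk⟩ := O.cover p
    exact ⟨k, hk, by simp⟩
  | insert _ _ ih =>
    obtain ⟨k, hk, hks⟩ := ih fun i hi => hp i (Set.mem_insert_of_mem _ hi)
    obtain ⟨l, hl, hlk⟩ := O.directed _ k p ⟨hp _ (Set.mem_insert _ _), hk⟩
    refine ⟨l, hl, ?_⟩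
    rintro i (rfl | hi)
    · exact hlk.trans inf_le_left
    · exact (hlk.trans inf_le_right).trans (hks i hi)

/-- A cover by the images `π '' B p` of connected open subsets `B p` of charts `Û (i p)`, such that
any two members that meet lie in some `U k` contained in both corresponding `U (i p)`. -/
theorem exists_good_cover [T2Space X] [ParacompactSpace X] :
    ∃ (i : X → I) (B : ∀ p, Set (O.dom (i p))),
      (∀ p, IsOpen (B p) ∧ IsConnected (B p) ∧ p ∈ O.π (i p) '' B p) ∧
      ∀ p q, (O.π (i p) '' B p ∩ O.π (i q) '' B q).Nonempty →
        ∃ k, O.U k ≤ O.U (i p) ∧ O.U k ≤ O.U (i q) ∧ O.π (i p) '' B p ⊆ O.U k := by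
  obtain ⟨v, F, -, hvf, hvu, hF, hFv, hFc⟩ :=
    exists_locallyFinite_closed_shrinking (u := fun i => (O.U i : Set X)) (fun i => (O.U i).2)
      (Set.iUnion_eq_univ_iff.mpr O.cover)
  have hFf : LocallyFinite F := hvf.subset hFv
  choose N hN hrN hNF using hFf.exists_isOpen_forall_inter_nonempty hF
  -- Around each `r` there is a chart `k r` contained in all the finitely many `U i` with `r ∈ F i`.
  choose k hk hkU using fun r => O.exists_le_of_finite (hFf.point_finite r)
    (p := r) fun i hi => hvu i (hFv i hi)
  -- Two meeting sets `V p`, `V q` will lie in one `N r ∩ U (k r)`, and `k r` will be the chart that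
  -- serves both.
  obtain ⟨V, hV, hVV⟩ := exists_nhds_union_subset (u := fun r => N r ∩ O.U (k r))
    (fun r => (hN r).inter (O.U (k r)).2)
    (Set.iUnion_eq_univ_iff.mpr fun r => ⟨r, hrN r, hk r⟩)
  choose i hi using Set.iUnion_eq_univ_iff.mp hFc
  -- The set `N r` meets `F (i p)` at `p`, so `r ∈ F (i p)`, and `k r` was chosen inside `U (i p)`.
  have hU : ∀ p r, p ∈ N r → O.U (k r) ≤ O.U (i p) := fun p r hp =>
    hkU r (i p) (hNF r (i p) ⟨p, hp, hi p⟩)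
  have hB : ∀ p, ∃ B : Set (O.dom (i p)), IsOpen B ∧ IsConnected B ∧ p ∈ O.π (i p) '' B ∧
      O.π (i p) '' B ⊆ V p := by
    intro p
    obtain ⟨x, hx⟩ := O.exists_π_eq (hvu _ (hFv _ (hi p)))
    have : LocallyConnectedSpace (O.dom (i p)) := (O.dom (i p)).2.locallyConnectedSpace
    have hxV : O.π (i p) ⁻¹' V p ∈ 𝓝 x :=
      ((hV p).1.preimage (O.continuous_π _)).mem_nhds
        (by rw [Set.mem_preimage, hx]; exact (hV p).2)
    obtain ⟨B, ⟨hBo, hxB, hBc⟩, hBV⟩ :=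
      (LocallyConnectedSpace.open_connected_basis x).mem_iff.mp hxV
    exact ⟨B, hBo, hBc, ⟨x, hxB, hx⟩, Set.image_subset_iff.mpr hBV⟩
  choose B hBo hBc hpB hBV using hB
  refine ⟨i, B, fun p => ⟨hBo p, hBc p, hpB p⟩, fun p q hpq => ?_⟩
  obtain ⟨r, hp, hq⟩ := hVV p q (hpq.mono (Set.inter_subset_inter (hBV p) (hBV q)))
  exact ⟨k r, hU p r (hp (hV p).2).1, hU q r (hq (hV q).2).1,
    (hBV p).trans (hp.trans Set.inter_subset_right)⟩

end SatakeOrbifold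

namespace SatakeOrbifold

variable {n : ℕ} {X : Type u} [TopologicalSpace X] {I : Type v} (O : SatakeOrbifold n X I)

/-! ### Germs of group elements -/

section

variable {k i j l : I} {hki : O.U k ≤ O.U i} {hkj : O.U k ≤ O.U j} {hkl : O.U k ≤ O.U l}
  {φ : O.dom k → O.dom i} {ψ : O.dom k → O.dom j} {χ : O.dom k → O.dom l}
  (hφ : φ ∈ O.inj k i hki) (hψ : ψ ∈ O.inj k j hkj) (hχ : χ ∈ O.inj k l hkl)

theorem inv_spanGerm (w : O.dom k) : (O.spanGerm hφ hψ w).inv = O.spanGerm hψ hφ w := by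
  rw [spanGerm, PseudogroupGerm.inv_mk]
  refine O.mk_eq_spanGerm hψ hφ _ _ (O.spanHomeo_apply hφ hψ w)
    (Filter.Eventually.of_forall fun w' => ?_)
  rw [← O.spanHomeo_apply hφ hψ]
  exact (O.spanHomeo hφ hψ).left_inv (O.mem_spanHomeo_source hφ hψ w')

theorem comp_spanGerm (w : O.dom k)
    (h : (O.spanGerm hψ hχ w).src = (O.spanGerm hφ hψ w).tgt) :
    (O.spanGerm hψ hχ w).comp (O.spanGerm hφ hψ w) h = O.spanGerm hφ hχ w := by
  obtain ⟨hx, hc⟩ := PseudogroupGerm.comp_mk _ _ (O.spanHomeo_mem hφ hψ) (O.spanHomeo_mem hψ hχ)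
    _ _ (O.mem_spanHomeo_source hφ hψ w) (O.mem_spanHomeo_source hψ hχ w) h
  refine hc.trans (O.mk_eq_spanGerm hφ hχ _ _ rfl (Filter.Eventually.of_forall fun w' => ?_))
  rw [OpenPartialHomeomorph.coe_trans, Function.comp_apply, O.spanHomeo_apply, O.spanHomeo_apply]

theorem unit_eq_spanGerm (w : O.dom k) : O.groupoid.unit ⟨i, φ w⟩ = O.spanGerm hφ hφ w :=
  O.mk_eq_spanGerm hφ hφ (e := OpenPartialHomeomorph.refl _) (StructureGroupoid.id_mem _) trivial
    rfl (Filter.Eventually.of_forall fun _ => rfl)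

end

/-- The germ at `x` of an element of the group of a chart. -/
noncomputable def groupGerm {i : I} (g : O.G i) (x : O.dom i) : O.Germ :=
  O.spanGerm (O.id_mem_inj i) (O.group_mem_inj g.2) x

section

variable {i : I} (g h : O.G i) (x : O.dom i)

theorem src_groupGerm : (O.groupGerm g x).src = ⟨i, x⟩ := rfl

theorem tgt_groupGerm : (O.groupGerm g x).tgt = ⟨i, g • x⟩ := O.tgt_spanGerm _ _ x

theorem continuous_groupGerm : Continuous (O.groupGerm g) := O.continuous_spanGerm _ _

theorem groupGerm_one : O.groupGerm 1 x = O.groupoid.unit ⟨i, x⟩ :=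
  (O.unit_eq_spanGerm (O.id_mem_inj i) x).symm

theorem inv_groupGerm : (O.groupGerm g x).inv = O.groupGerm g⁻¹ (g • x) := by
  rw [groupGerm, inv_spanGerm]
  exact (O.spanGerm_comp (O.id_mem_inj i) (O.group_mem_inj (g⁻¹).2) (O.group_mem_inj g.2)
    (O.id_mem_inj i) (θ := fun v => g • v) (fun v => rfl) (fun v => inv_smul_smul g v) x).symm

theorem comp_groupGerm (hgh : (O.groupGerm h (g • x)).src = (O.groupGerm g x).tgt) :
    (O.groupGerm h (g • x)).comp (O.groupGerm g x) hgh = O.groupGerm (h * g) x := by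
  have h₁ : O.groupGerm h (g • x) =
      O.spanGerm (O.group_mem_inj g.2) (O.group_mem_inj (h * g).2) x :=
    O.spanGerm_comp (O.id_mem_inj i) (O.group_mem_inj h.2) (O.group_mem_inj g.2)
      (O.group_mem_inj (h * g).2) (θ := fun v => g • v) (fun v => rfl) (fun v => rfl) x
  simp only [h₁]
  exact O.comp_spanGerm _ _ _ x _

variable {g h x} in
theorem groupGerm_injective (hgh : O.groupGerm g x = O.groupGerm h x) : g = h := by
  have h₁ := O.eq_of_spanGerm_eq _ _ _ hgh
  exact Subtype.ext (Homeomorph.ext fun y => congrFun h₁ y)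

variable {x} in
-- Represent the germ over the identity injection of the chart; by transitivity the injections of a
-- chart into itself are exactly the group elements.
theorem exists_eq_groupGerm {y : O.dom i} {γ : O.Germ} (hs : γ.src = ⟨i, x⟩)
    (ht : γ.tgt = ⟨i, y⟩) : ∃ g : O.G i, γ = O.groupGerm g x ∧ g • x = y := by
  obtain ⟨ψ, hψ, rfl, rfl⟩ := O.exists_eq_spanGerm le_rfl le_rfl (O.id_mem_inj i) (w := x) hs ht
  obtain ⟨g, hg, hgψ⟩ := O.inj_transitive i i le_rfl _ (O.id_mem_inj i) ψ hψ
  obtain rfl : ψ = fun x => g x := funext hgψ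
  exact ⟨⟨g, hg⟩, rfl, rfl⟩

end

/-! ### Sheets over an open subset of a chart -/

/-- `S` is an open union of connected components of `π⁻¹ V`, mapped onto `V`, and every element of
`G i` that maps some point of `S` into `S` maps all of `S` into `S`. -/
structure IsSheet {i : I} (V : Set X) (S : Set (O.dom i)) : Prop where
  isOpen : IsOpen S
  image : O.π i '' S = V
  stable : ∀ g : O.G i, ∀ x ∈ S, g • x ∈ S → ∀ y ∈ S, g • y ∈ S
  absorbs : ∀ T : Set (O.dom i), IsPreconnected T → T ⊆ O.π i ⁻¹' V → (T ∩ S).Nonempty → T ⊆ S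

theorem π_smul {i : I} (g : O.G i) (x : O.dom i) : O.π i (g • x) = O.π i x := O.π_apply g.2 x

theorem π_eq_iff_smul {i : I} {x y : O.dom i} : O.π i x = O.π i y ↔ ∃ g : O.G i, g • x = y :=
  (O.uniformizes i).eq_iff

theorem isSheet_preimage {i : I} {V : Set X} (hV : IsOpen V) (hVU : V ⊆ O.U i) :
    O.IsSheet V (O.π i ⁻¹' V) where
  isOpen := hV.preimage (O.continuous_π i)
  image := by
    rw [Set.image_preimage_eq_iff]
    exact fun p hp => O.exists_π_eq (hVU hp)
  stable g x _ _ y hy := by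
    rw [Set.mem_preimage, O.π_smul]
    exact hy
  absorbs _ _ h _ := h

/-- Group elements carry connected subsets of `π⁻¹ V` to connected subsets of it. That a single
component maps onto `V` relies on `V` being the image of a connected `B`: the translate of `B`
through `x` stays in the component. -/
theorem isSheet_connectedComponentIn {i : I} {B : Set (O.dom i)} (hBo : IsOpen B)
    (hB : IsPreconnected B) {x : O.dom i} (hx : x ∈ O.π i ⁻¹' (O.π i '' B)) :
    O.IsSheet (O.π i '' B) (connectedComponentIn (O.π i ⁻¹' (O.π i '' B)) x) := by
  set V := O.π i '' B with hV
  set S := connectedComponentIn (O.π i ⁻¹' V) x with hS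
  have hlc : LocallyConnectedSpace (O.dom i) := (O.dom i).2.locallyConnectedSpace
  have habs : ∀ T : Set (O.dom i), IsPreconnected T → T ⊆ O.π i ⁻¹' V → (T ∩ S).Nonempty →
      T ⊆ S := by
    rintro T hT hTV ⟨y, hyT, hyS⟩
    rw [hS, connectedComponentIn_eq hyS]
    exact hT.subset_connectedComponentIn hyT hTV
  have hSV : S ⊆ O.π i ⁻¹' V := connectedComponentIn_subset _ _
  have hsmul : ∀ (g : O.G i) (T : Set (O.dom i)), T ⊆ O.π i ⁻¹' V →
      (fun y => g • y) '' T ⊆ O.π i ⁻¹' V := by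
    rintro g T hT _ ⟨y, hy, rfl⟩
    change O.π i (g • y) ∈ V
    rw [O.π_smul]
    exact hT hy
  have hpre : ∀ (g : O.G i) (T : Set (O.dom i)), IsPreconnected T →
      IsPreconnected ((fun y => g • y) '' T) := fun g T hT =>
    hT.image _ (continuous_const_smul g).continuousOn
  refine ⟨((O.isOpenMap_π i _ hBo).preimage (O.continuous_π i)).connectedComponentIn, ?_, ?_, habs⟩
  · refine (Set.image_subset_iff.mpr hSV).antisymm ?_
    obtain ⟨b, hb, hbx⟩ := hx
    obtain ⟨g, hg⟩ := O.π_eq_iff_smul.mp hbx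
    have hgB := habs _ (hpre g B hB) (hsmul g B (Set.subset_preimage_image _ _))
      ⟨x, ⟨b, hb, hg⟩, mem_connectedComponentIn ⟨b, hb, hbx⟩⟩
    rintro _ ⟨c, hc, rfl⟩
    exact ⟨g • c, hgB ⟨c, hc, rfl⟩, O.π_smul g c⟩
  · intro g y hy hgy z hz
    exact habs _ (hpre g S isPreconnected_connectedComponentIn) (hsmul g S hSV)
      ⟨g • y, ⟨y, hy, rfl⟩, hgy⟩ ⟨z, hz, rfl⟩

variable {O}

namespace IsSheet

variable {i : I} {V : Set X} {S : Set (O.dom i)}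

theorem π_mem (h : O.IsSheet V S) {x : O.dom i} (hx : x ∈ S) : O.π i x ∈ V :=
  h.image ▸ Set.mem_image_of_mem _ hx

theorem mem_stabilizer (h : O.IsSheet V S) {g : O.G i} {x : O.dom i} (hx : x ∈ S)
    (hgx : g • x ∈ S) : g ∈ MulAction.stabilizer (O.G i) S := by
  rw [MulAction.mem_stabilizer_set]
  refine fun y => ⟨fun hy => ?_, h.stable g x hx hgx y⟩
  have := h.stable g⁻¹ (g • x) hgx (by rwa [inv_smul_smul]) _ hy
  rwa [inv_smul_smul] at this

theorem inducesHomeomorph (h : O.IsSheet V S) :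
    InducesHomeomorph (MulAction.stabilizer (O.G i) S) (fun x : S => O.π i x) V := by
  refine inducesHomeomorph_of_isOpenMap ((O.continuous_π i).comp continuous_subtype_val)
    ((O.isOpenMap_π i).comp h.isOpen.isOpenMap_subtype_val) ?_ fun x y => ?_
  · rw [← h.image, Set.image_eq_range]
  · rw [O.π_eq_iff_smul]
    constructor
    · rintro ⟨g, hg⟩
      exact ⟨⟨g, h.mem_stabilizer x.2 (hg ▸ y.2)⟩, Subtype.ext hg⟩
    · rintro ⟨g, hg⟩
      exact ⟨g, congrArg Subtype.val hg⟩

end IsSheet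

/-- The image of an injection is relatively closed over the corresponding open subset of `X`. -/
theorem subset_range_inj {l i : I} {hli : O.U l ≤ O.U i} {φ : O.dom l → O.dom i}
    (hφ : φ ∈ O.inj l i hli) {T : Set (O.dom i)} (hT : IsPreconnected T)
    (hTU : T ⊆ O.π i ⁻¹' O.U l) (hne : (T ∩ Set.range φ).Nonempty) : T ⊆ Set.range φ := by
  have hop : ∀ g : O.G i, IsOpen (Set.range fun w => g • φ w) := fun g =>
    (O.inj_isOpenEmbedding l i hli _ (O.inj_smul l i hli φ hφ g g.2)).isOpen_range
  -- The translates of the image of `φ` cover the preimage of `U l`, and one that meets the image is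
  -- contained in it by `exists_comp_eq`. The remaining ones form an open set disjoint from the
  -- image, and `T` is connected.
  refine hT.subset_left_of_subset_union (O.inj_isOpenEmbedding l i hli φ hφ).isOpen_range
    (v := ⋃ g ∈ {g : O.G i | Disjoint (Set.range φ) (Set.range fun w => g • φ w)},
      Set.range fun w => g • φ w) (isOpen_biUnion fun g _ => hop g) ?_ ?_ hne
  · exact Set.disjoint_iUnion₂_right.mpr fun g hg => hg
  · intro x hx
    obtain ⟨w, hw⟩ := O.exists_π_eq (hTU hx)
    obtain ⟨g, hg⟩ := O.π_eq_iff_smul.mp ((O.π_inj l i hli φ hφ w).trans hw)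
    by_cases h : Disjoint (Set.range φ) (Set.range fun w => g • φ w)
    · exact Or.inr (Set.mem_biUnion h ⟨w, hg⟩)
    · obtain ⟨_, ⟨w₂, rfl⟩, w₁, hw₁⟩ := Set.not_disjoint_iff.mp h
      obtain ⟨g', -, hg'⟩ := O.exists_comp_eq hφ g.2 hw₁
      exact Or.inl ⟨g' w, (hg' w).symm.trans hg⟩

/-! ### The restriction of the groupoid to a family of sheets -/

section Sheets

variable {A : Type w} {i : A → I} {V : A → Set X} {S : ∀ a, Set (O.dom (i a))}

theorem isLocalHomeomorph_sheetMap (hS : ∀ a, IsOpen (S a)) :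
    IsLocalHomeomorph (O.sheetMap i S) :=
  isLocalHomeomorph_sigma fun a =>
    (Topology.IsOpenEmbedding.sigmaMk (σ := fun j => O.dom j) (i := i a)).comp
      (hS a).isOpenEmbedding_subtypeVal

theorem isEquivalence_of_isSheet (hS : ∀ a, O.IsSheet (V a) (S a)) (hV : ⋃ a, V a = Set.univ) :
    (O.groupoid.restrictHom (O.sheetMap i S) (O.continuous_sheetMap i S)).IsEquivalence := by
  refine TopologicalGroupoid.isEquivalence_restrictHom (isEtale_germGroupoid _)
    (isLocalHomeomorph_sheetMap fun a => (hS a).isOpen) ?_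
  rintro ⟨j, y⟩
  obtain ⟨a, ha⟩ := Set.mem_iUnion.mp (hV ▸ Set.mem_univ (O.π j y))
  rw [← (hS a).image] at ha
  obtain ⟨x, hx, hxy⟩ := ha
  exact ⟨⟨a, x, hx⟩, O.exists_germ hxy⟩

variable (O i S) in
/-- The restriction of the groupoid of an orbifold to a family of subsets of its charts. -/
noncomputable abbrev sheetGroupoid : TopologicalGroupoid (Σ a, S a) :=
  O.groupoid.restrict (O.sheetMap i S) (O.continuous_sheetMap i S)

theorem isEtale_sheetGroupoid (hS : ∀ a, IsOpen (S a)) : (O.sheetGroupoid i S).IsEtale :=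
  (isEtale_germGroupoid _).restrict (isLocalHomeomorph_sheetMap hS)

/-- An arrow of the twice restricted groupoid carries its ends twice; the inner copies are
determined by the outer ones. -/
theorem sheetGroupoid_restrict_ext {a : A}
    {t t' : ((O.sheetGroupoid i S).restrict (Sigma.mk a) continuous_sigmaMk).Arr}
    (h₁ : t.1.1 = t'.1.1) (h₂ : t.1.2.1 = t'.1.2.1) (h₃ : t.1.2.2.1.2.2 = t'.1.2.2.1.2.2) :
    t = t' := by
  obtain ⟨⟨x, y, ⟨⟨z, z', γ⟩, hγ⟩⟩, hx, hy⟩ := t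
  obtain ⟨⟨x', y', ⟨⟨w, w', γ'⟩, hγ'⟩⟩, hx', hy'⟩ := t'
  obtain rfl : x = x' := h₁
  obtain rfl : y = y' := h₂
  obtain rfl : γ = γ' := h₃
  obtain rfl : z = ⟨a, x⟩ := hx
  obtain rfl : z' = ⟨a, y⟩ := hy
  obtain rfl : w = ⟨a, x⟩ := hx'
  obtain rfl : w' = ⟨a, y⟩ := hy'
  rfl

/-- The arrow given by the germ of a group element. -/
noncomputable def groupArrow (S : ∀ a, Set (O.dom (i a))) {a : A}
    (g : MulAction.stabilizer (O.G (i a)) (S a)) (x : S a) :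
    ((O.sheetGroupoid i S).restrict (Sigma.mk a) continuous_sigmaMk).Arr :=
  ⟨(x, g • x, ⟨(⟨a, x⟩, ⟨a, g • x⟩, O.groupGerm g.1 x.1),
    O.src_groupGerm g.1 x.1, O.tgt_groupGerm g.1 x.1⟩), rfl, rfl⟩

section

variable {a : A} (g h : MulAction.stabilizer (O.G (i a)) (S a)) (x : S a)

theorem continuous_groupArrow : Continuous (groupArrow S g) := by
  have h₁ : Continuous fun x : S a => g • x := continuous_const_smul g
  have h₂ : Continuous fun x : S a => (⟨a, x⟩ : Σ a, S a) :=
    continuous_sigmaMk (σ := fun a => S a)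
  have h₃ : Continuous fun x : S a => O.groupGerm g.1 x.1 :=
    (O.continuous_groupGerm g.1).comp continuous_subtype_val
  have h₄ : Continuous fun x : S a => (groupArrow S g x).1.2.2 :=
    Continuous.subtype_mk (h₂.prodMk ((h₂.comp h₁).prodMk h₃)) _
  exact (continuous_id.prodMk (h₁.prodMk h₄)).subtype_mk _

theorem groupArrow_one : groupArrow S 1 x =
    ((O.sheetGroupoid i S).restrict (Sigma.mk a) continuous_sigmaMk).unit x :=
  sheetGroupoid_restrict_ext (Eq.refl x) (one_smul _ x) (O.groupGerm_one x.1)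

theorem groupArrow_inv : groupArrow S g⁻¹ (g • x) =
    ((O.sheetGroupoid i S).restrict (Sigma.mk a) continuous_sigmaMk).inv (groupArrow S g x) :=
  sheetGroupoid_restrict_ext (Eq.refl (g • x)) (inv_smul_smul g x) (O.inv_groupGerm g.1 x.1).symm

theorem groupArrow_mul : groupArrow S (h * g) x =
    ((O.sheetGroupoid i S).restrict (Sigma.mk a) continuous_sigmaMk).comp
      (groupArrow S h (g • x)) (groupArrow S g x) rfl :=
  sheetGroupoid_restrict_ext (Eq.refl x) (mul_smul h g x) 
    (O.comp_groupGerm g.1 h.1 x.1 (O.tgt_groupGerm g.1 x.1).symm).symm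

end

/-- The homomorphism from the product groupoid given by the germs of the group elements. -/
noncomputable def productHom (S : ∀ a, Set (O.dom (i a))) (a : A)
    [TopologicalSpace (MulAction.stabilizer (O.G (i a)) (S a))]
    [DiscreteTopology (MulAction.stabilizer (O.G (i a)) (S a))] :
    TopologicalGroupoid.Hom
      (TopologicalGroupoid.product (MulAction.stabilizer (O.G (i a)) (S a)) (S a))
      ((O.sheetGroupoid i S).restrict (Sigma.mk a) continuous_sigmaMk) where
  obj := id
  map t := groupArrow S t.1 t.2
  continuous_obj := continuous_id
  continuous_map := continuous_prod_of_discrete_left.mpr fun g => continuous_groupArrow g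
  src_map _ := rfl
  tgt_map _ := rfl
  map_unit x := groupArrow_one x
  map_inv t := groupArrow_inv t.1 t.2
  map_comp := by
    rintro ⟨h, z⟩ ⟨g, x⟩ hgh
    obtain rfl : z = g • x := hgh
    exact groupArrow_mul g h x

/-- The map commutes with the source maps, both local homeomorphisms, hence is one itself.
Injectivity is rigidity. For surjectivity, an arrow is the germ of a group element taking a point of
the sheet into the sheet, and such an element stabilizes it. -/
theorem isHomeomorph_productHom (hS : ∀ a, O.IsSheet (V a) (S a)) (a : A)
    [TopologicalSpace (MulAction.stabilizer (O.G (i a)) (S a))]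
    [DiscreteTopology (MulAction.stabilizer (O.G (i a)) (S a))] :
    IsHomeomorph (productHom S a).map := by
  have hsnd : IsLocalHomeomorph
      (Prod.snd : MulAction.stabilizer (O.G (i a)) (S a) × S a → S a) := by
    refine isLocalHomeomorph_of_isOpenMap continuous_snd isOpenMap_snd ?_
    rintro ⟨g, x⟩
    refine ⟨{g} ×ˢ Set.univ, (isOpen_discrete _).prod isOpen_univ, ⟨rfl, trivial⟩, ?_⟩
    rintro ⟨g₁, x₁⟩ ⟨h₁, -⟩ ⟨g₂, x₂⟩ ⟨h₂, -⟩ h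
    exact Prod.ext (h₁.trans h₂.symm) h
  have hl : IsLocalHomeomorph (productHom S a).map :=
    IsLocalHomeomorph.of_comp (f := (productHom S a).map)
      (g := ((O.sheetGroupoid i S).restrict (Sigma.mk a) continuous_sigmaMk).src) hsnd
      ((isEtale_sheetGroupoid fun a => (hS a).isOpen).restrict
        Topology.IsOpenEmbedding.sigmaMk.isLocalHomeomorph).src (productHom S a).continuous_map
  refine ⟨hl.continuous, hl.isOpenMap, ?_, ?_⟩
  · rintro ⟨g₁, x₁⟩ ⟨g₂, x₂⟩ h
    obtain rfl : x₁ = x₂ := congrArg (fun t => t.1.1) h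
    have h₁ : O.groupGerm g₁.1 x₁.1 = O.groupGerm g₂.1 x₁.1 :=
      congrArg (fun t => t.1.2.2.1.2.2) h
    exact Prod.ext (Subtype.ext (O.groupGerm_injective h₁)) rfl
  · rintro ⟨⟨x, y, ⟨⟨x', y', γ⟩, hs, ht⟩⟩, hx, hy⟩
    obtain rfl : x' = ⟨a, x⟩ := hx
    obtain rfl : y' = ⟨a, y⟩ := hy
    obtain ⟨g, rfl, hg⟩ := O.exists_eq_groupGerm (i := i a) (x := x.1) (y := y.1) hs ht
    obtain ⟨y, hyS⟩ := y
    obtain rfl : g • x.1 = y := hg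
    exact ⟨(⟨g, (hS a).mem_stabilizer x.2 hyS⟩, x), rfl⟩

theorem isOrbispace_of_isSheet (hS : ∀ a, O.IsSheet (V a) (S a)) (hVo : ∀ a, IsOpen (V a))
    (hV : ⋃ a, V a = Set.univ) :
    (O.sheetGroupoid i S).IsOrbispace V (fun a => MulAction.stabilizer (O.G (i a)) (S a))
      (fun a x => O.π (i a) x) where
  etale := isEtale_sheetGroupoid fun a => (hS a).isOpen
  isOpen := hVo
  cover := hV
  chart a := (hS a).inducesHomeomorph
  product a := by
    let : TopologicalSpace (MulAction.stabilizer (O.G (i a)) (S a)) := ⊥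
    have : DiscreteTopology (MulAction.stabilizer (O.G (i a)) (S a)) := ⟨rfl⟩
    exact ⟨productHom S a, rfl, isHomeomorph_productHom hS a⟩
  orbits := by
    have hrange : Set.range (fun y : Σ a, S a => O.π (i y.1) y.2) = Set.univ := by
      refine Set.eq_univ_of_forall fun p => ?_
      obtain ⟨a, ha⟩ := Set.mem_iUnion.mp (hV ▸ Set.mem_univ p)
      rw [← (hS a).image] at ha
      obtain ⟨x, hx, hxp⟩ := ha
      exact ⟨⟨a, x, hx⟩, hxp⟩
    obtain ⟨h, hh⟩ := exists_homeomorph_quotient (s := (O.sheetGroupoid i S).orbitSetoid)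
      (continuous_sigma fun a => (O.continuous_π (i a)).comp continuous_subtype_val)
      (isOpenMap_sigma.mpr fun a =>
        (O.isOpenMap_π (i a)).comp (hS a).isOpen.isOpenMap_subtype_val) hrange (by
        rintro ⟨a, x⟩ ⟨b, y⟩
        constructor
        · rintro ⟨⟨⟨x', y', γ⟩, hs, ht⟩, h₁, h₂⟩
          obtain rfl : x' = ⟨a, x⟩ := h₁
          obtain rfl : y' = ⟨b, y⟩ := h₂
          exact O.π_eq_of_germ hs ht
        · intro h
          obtain ⟨γ, hs, ht⟩ := O.exists_germ h
          exact ⟨⟨(⟨a, x⟩, ⟨b, y⟩, γ), hs, ht⟩, rfl, rfl⟩)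
    exact ⟨h.trans (Homeomorph.Set.univ X), fun a y => hh ⟨a, y⟩⟩

/-! ### Conditions (C1) and (C2) for families of sheets. -/

theorem c1_sheetGroupoid (hS : ∀ a, IsOpen (S a)) : (O.sheetGroupoid i S).C1 := by
  have h : IsLocalHomeomorph fun x : Σ a, S a => (x.2.1 : EuclideanSpace ℝ (Fin n)) :=
    isLocalHomeomorph_sigma fun a =>
      (O.dom (i a)).2.isOpenEmbedding_subtypeVal.comp (hS a).isOpenEmbedding_subtypeVal
  exact (h.comp (isEtale_sheetGroupoid hS).src).locallyConnectedSpace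

instance t2Space_sheetGroupoid : T2Space (O.sheetGroupoid i S).Arr :=
  inferInstanceAs (T2Space {t : (Σ a, S a) × (Σ a, S a) × O.Germ //
    t.2.2.src = O.sheetMap i S t.1 ∧ t.2.2.tgt = O.sheetMap i S t.2.1})

/-- A germ `ψ ∘ φ⁻¹` over `U l` is continued along the whole component `W` of the source image,
giving a section to which `isEmbedding_and_image_connectedComponentIn` applies. -/
theorem c2_sheetGroupoid (hS : ∀ a, O.IsSheet (V a) (S a))
    (hV : ∀ a b, (V a ∩ V b).Nonempty →
      ∃ l, O.U l ≤ O.U (i a) ∧ O.U l ≤ O.U (i b) ∧ V a ∩ V b ⊆ O.U l) :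
    (O.sheetGroupoid i S).C2 := by
  refine TopologicalGroupoid.C2_of_src ?_
  rintro a b ⟨⟨⟨a', x⟩, ⟨b', y⟩, γ⟩, hs, ht⟩ ⟨ha, hb⟩
  obtain rfl : a' = a := ha
  obtain rfl : b' = b := hb
  have hxy : O.π (i a') x = O.π (i b') y := O.π_eq_of_germ hs ht
  obtain ⟨l, hla, hlb, hl⟩ := hV a' b' ⟨_, (hS a').π_mem x.2, hxy ▸ (hS b').π_mem y.2⟩
  obtain ⟨w₀, hw₀⟩ := O.exists_π_eq (hl ⟨(hS a').π_mem x.2, hxy ▸ (hS b').π_mem y.2⟩)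
  obtain ⟨φ, hφ, hφw₀⟩ := O.exists_inj_apply_eq hla hw₀
  obtain ⟨ψ, hψ, rfl, hψw₀⟩ := O.exists_eq_spanGerm hla hlb hφ (w := w₀) (y := y.1)
    (hs.trans (by rw [hφw₀]; rfl)) ht
  set N := (O.sheetGroupoid i S).chartArrows a' b'
  set t : (O.sheetGroupoid i S).Arr :=
    ⟨(⟨a', x⟩, ⟨b', y⟩, O.spanGerm hφ hψ w₀), hs, ht⟩
  have htN : t ∈ N := ⟨rfl, rfl⟩
  set W := connectedComponentIn ((O.sheetGroupoid i S).src '' N) ((O.sheetGroupoid i S).src t)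
  have hWN : ∀ z ∈ W, ∃ z₀ : S a', z = ⟨a', z₀⟩ ∧ O.π (i a') z₀ ∈ V a' ∩ V b' := by
    intro z hz
    obtain ⟨⟨⟨⟨a, z⟩, ⟨b, z'⟩, γ'⟩, hs', ht'⟩, ⟨ha, hb⟩, rfl⟩ :=
      connectedComponentIn_subset _ _ hz
    obtain rfl : a = a' := ha
    obtain rfl : b = b' := hb
    have hzz' : O.π (i a) z = O.π (i b) z' := O.π_eq_of_germ hs' ht'
    exact ⟨z, rfl, (hS a).π_mem z.2, hzz' ▸ (hS b).π_mem z'.2⟩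
  -- `T` is `W` viewed inside the chart. It is connected and lies over `V a' ∩ V b'`, hence over `U
  -- l`, so it stays in the image of `φ`.
  let T : Set (O.dom (i a')) := Subtype.val '' ((fun s : S a' => (⟨a', s⟩ : Σ a, S a)) ⁻¹' W)
  have hT : IsPreconnected T := by
    refine IsPreconnected.image ?_ _ continuous_subtype_val.continuousOn
    refine isPreconnected_connectedComponentIn.preimage_of_isOpenMap
      (sigma_mk_injective (β := fun a => S a))
      (isOpenMap_sigmaMk (σ := fun a => S a)) fun z hz => ?_
    obtain ⟨z₀, rfl, -⟩ := hWN z hz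
    exact ⟨z₀, rfl⟩
  have hTV : ∀ z ∈ T, O.π (i a') z ∈ V a' ∩ V b' := by
    rintro _ ⟨z, hz, rfl⟩
    obtain ⟨z₀, h₁, h₂⟩ := hWN _ hz
    obtain rfl := sigma_mk_injective h₁
    exact h₂
  have hxT : φ w₀ ∈ T := ⟨x, mem_connectedComponentIn (Set.mem_image_of_mem _ htN), hφw₀.symm⟩
  have hTφ : T ⊆ Set.range φ := subset_range_inj hφ hT (fun z hz => hl (hTV z hz))
    ⟨_, hxT, ⟨w₀, rfl⟩⟩
  -- The continued targets form a connected set over `V b'` through `y`, so the sheet `S b'` absorbs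
  -- them; without this the section could leave the arrows from `a'` to `b'`.
  have hψT : ψ '' (φ ⁻¹' T) ⊆ S b' := by
    have hφo := O.inj_isOpenEmbedding l _ hla φ hφ
    refine (hS b').absorbs _ ((hT.preimage_of_isOpenMap hφo.injective hφo.isOpenMap hTφ).image _
      (O.continuous_inj hψ).continuousOn) ?_ ⟨ψ w₀, ⟨w₀, hxT, rfl⟩, hψw₀ ▸ y.2⟩
    rintro _ ⟨w, hw, rfl⟩
    rw [Set.mem_preimage, O.π_inj l _ hlb ψ hψ, ← O.π_inj l _ hla φ hφ]
    exact (hTV _ hw).2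
  have hsec : ∀ z : W, ∃ w, (⟨i a', φ w⟩ : Σ i, O.dom i) = O.sheetMap i S z ∧ ψ w ∈ S b' := by
    rintro ⟨z, hz⟩
    obtain ⟨z₀, rfl, -⟩ := hWN z hz
    have hz₀ : z₀.1 ∈ T := ⟨z₀, hz, rfl⟩
    obtain ⟨w, hw⟩ := hTφ hz₀
    exact ⟨w, by rw [hw]; rfl, hψT ⟨w, by rwa [Set.mem_preimage, hw], rfl⟩⟩
  -- Here `f` is `φ⁻¹` on `W`; the section sends `z` to the germ of `ψ ∘ φ⁻¹` at `z`.
  choose f hfφ hfψ using hsec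
  have hf : Continuous f := by
    rw [(O.isOpenEmbedding_sigmaMk_inj hφ).isInducing.continuous_iff]
    have : (fun w => (⟨i a', φ w⟩ : Σ i, O.dom i)) ∘ f = fun z : W => O.sheetMap i S z :=
      funext hfφ
    rw [this]
    exact (O.continuous_sheetMap i S).comp continuous_subtype_val
  have hfψc : Continuous fun z : W => (⟨b', ψ (f z), hfψ z⟩ : Σ a, S a) :=
    continuous_sigmaMk.comp (((O.continuous_inj hψ).comp hf).subtype_mk hfψ)
  refine isEmbedding_and_image_connectedComponentIn (O.sheetGroupoid i S).continuous_src
    (isEtale_sheetGroupoid fun a => (hS a).isOpen).src.isLocallyInjective htN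
    (ρ := fun z => ⟨(z.1, ⟨b', ψ (f z), hfψ z⟩, O.spanGerm hφ hψ (f z)), hfφ z,
      O.tgt_spanGerm hφ hψ (f z)⟩) ?_ (fun _ => rfl) ?_ ?_
  · exact (continuous_subtype_val.prodMk
      (hfψc.prodMk ((O.continuous_spanGerm hφ hψ).comp hf))).subtype_mk _
  · rintro ⟨z, hz⟩
    obtain ⟨z₀, rfl, -⟩ := hWN z hz
    exact ⟨rfl, rfl⟩
  · intro h
    have hfw : f ⟨_, h⟩ = w₀ := (O.isOpenEmbedding_sigmaMk_inj hφ).injective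
      ((hfφ ⟨_, h⟩).trans hs.symm)
    refine Subtype.ext (Prod.ext rfl (Prod.ext ?_ ?_))
    · refine congrArg (Sigma.mk b') (Subtype.ext ?_)
      change ψ (f ⟨_, h⟩) = y
      rw [hfw, hψw₀]
    · exact congrArg (O.spanGerm hφ hψ) hfw

end Sheets

end SatakeOrbifold

/-! ### Assembly of the proposition. -/

theorem proposition2p1p3 {n : ℕ} {X : Type u} [TopologicalSpace X] [T2Space X] [ParacompactSpace X]
    {I : Type v} (O : SatakeOrbifold n X I) :
    ∃ (A : Type u) (V : A → Set X) (i : A → I),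
      (∀ a, IsOpen (V a) ∧ IsConnected (V a) ∧ V a ⊆ O.U (i a)) ∧
      ⋃ a, V a = Set.univ ∧
      ∀ S : ∀ a, Set (O.dom (i a)),
        (∀ a, S a = O.π (i a) ⁻¹' V a ∨
          ∃ x ∈ O.π (i a) ⁻¹' V a, S a = connectedComponentIn (O.π (i a) ⁻¹' V a) x) →
        (O.groupoid.restrictHom (O.sheetMap i S) (O.continuous_sheetMap i S)).IsEquivalence ∧
        (O.groupoid.restrict (O.sheetMap i S) (O.continuous_sheetMap i S)).IsOrbispace V
          (fun a => MulAction.stabilizer (O.G (i a)) (S a)) (fun a x => O.π (i a) x) ∧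
        (O.groupoid.restrict (O.sheetMap i S) (O.continuous_sheetMap i S)).C1 ∧
        (O.groupoid.restrict (O.sheetMap i S) (O.continuous_sheetMap i S)).C2 := by
  obtain ⟨i, B, hB, hBB⟩ := O.exists_good_cover
  have hVo : ∀ p, IsOpen (O.π (i p) '' B p) := fun p => O.isOpenMap_π _ _ (hB p).1
  have hVU : ∀ p, O.π (i p) '' B p ⊆ O.U (i p) := fun p =>
    Set.image_subset_iff.mpr fun x _ => O.π_mem x
  have hV : ⋃ p, O.π (i p) '' B p = Set.univ :=
    Set.iUnion_eq_univ_iff.mpr fun p => ⟨p, (hB p).2.2⟩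
  -- The cover is indexed by the points of `X`, with one member around each point.
  refine ⟨X, fun p => O.π (i p) '' B p, i, fun p => ⟨hVo p,
    (hB p).2.1.image _ (O.continuous_π _).continuousOn, hVU p⟩, hV, fun S hS => ?_⟩
  have hS' : ∀ p, O.IsSheet (O.π (i p) '' B p) (S p) := by
    intro p
    rcases hS p with h | ⟨x, hx, h⟩
    · rw [h]
      exact O.isSheet_preimage (hVo p) (hVU p)
    · rw [h]
      exact O.isSheet_connectedComponentIn (hB p).1 (hB p).2.1.isPreconnected hx
  refine ⟨SatakeOrbifold.isEquivalence_of_isSheet hS' hV,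
    SatakeOrbifold.isOrbispace_of_isSheet hS' hVo hV,
    SatakeOrbifold.c1_sheetGroupoid fun p => (hS' p).isOpen,
    SatakeOrbifold.c2_sheetGroupoid hS' fun p q hpq => ?_⟩
  obtain ⟨k, hkp, hkq, hk⟩ := hBB p q hpq
  exact ⟨k, hkp, hkq, Set.inter_subset_left.trans hk⟩
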